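/- Let $A$ be a simple $C^*$-algebra (its only closed two-sided ideals are $0$ and $A$) and let $B$ be a $C^*$-algebra; neither is assumed to be unital. Let $A\otimes B$ denote the minimal (spatial) tensor product, that is, for faithful representations $\pi\colon A\to\mathbb B(H)$ and $\rho\colon B\to\mathbb B(K)$, the closed linear span of the operators $\pi(a)\otimes\rho(b)$ in $\mathbb B(H\otimes K)$. Let $C\subset A\otimes B$ be a $C^*$-subalgebra closed under multiplication by $A$, i.e. $(a\otimes 1)c\in C$ and $c(a\otimes 1)\in C$ for all $a\in A$, $c\in C$. For $\varphi\in A^*$ let $\varphi\otimes\mathrm{id}_B\colon A\otimes B\to B$ be the bounded linear map with $a\otimes b\mapsto\varphi(a)b$, and put \[\mathcal S_A(C):=\{(\varphi\otimes\mathrm{id}_B)(c) : \varphi\in A^*,\ c\in C\}\subset B.\] Then $\mathcal S_A(C)$ is a $C^*$-subalgebra of $B$, and $A\otimes\mathcal S_A(C)\subset C$, where $A\otimes\mathcal S_A(C)$ is the closed linear span of $\{a\otimes s : a\in A,\ s\in\mathcal S_A(C)\}$ in $A\otimes B$. Moreover, $C=A\otimes\mathcal S_A(C)$ holds in each of the following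 two cases. (1) $A$ has the strong operator approximation property: there is a net $(\varphi_i)$ of bounded finite-rank linear maps $A\to A$ such that $\|(\varphi_i\otimes\mathrm{id})(x)-x\|\to 0$ for every $x\in A\otimes\mathbb B(\ell^2(\mathbb N))$. (2) There is a completely bounded projection of $B$ onto $\mathcal S_A(C)$, i.e. a completely bounded linear map $P\colon B\to B$ with $P(B)\subset\mathcal S_A(C)$ and $P(s)=s$ for all $s\in\mathcal S_A(C)$. -/

import Mathlib

open scoped TensorProduct

noncomputable section

namespace TensorSplitting

/-- A C⋆-algebra is simple if `0` and `A` are its only closed two-sided ideals. -/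
def IsSimple (A : Type*) [NonUnitalCStarAlgebra A] : Prop :=
  ∀ I : Submodule ℂ A, IsClosed (I : Set A) →
    (∀ a x : A, x ∈ I → a * x ∈ I ∧ x * a ∈ I) → I = ⊥ ∨ I = ⊤

/-- A linear map `P` between C⋆-algebras is completely bounded if its entrywise amplifications
`Mₙ(A) → Mₙ(B)` are bounded uniformly in `n`, for the C⋆-norms on the matrix algebras. (Mathlib's
norm on `CStarMatrix` asks for the canonical order of the C⋆-algebra, which is supplied here.) -/
def IsCompletelyBounded {A B : Type*} [NonUnitalCStarAlgebra A] [NonUnitalCStarAlgebra B]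
    (P : A →ₗ[ℂ] B) : Prop :=
  letI := CStarAlgebra.spectralOrder A
  letI := CStarAlgebra.spectralOrder B
  haveI := CStarAlgebra.spectralOrderedRing A
  haveI := CStarAlgebra.spectralOrderedRing B
  ∃ M : ℝ, ∀ (n : ℕ) (x : CStarMatrix (Fin n) (Fin n) A), ‖x.map P‖ ≤ M * ‖x‖

/-- The inclusion `S ⊆ B` admits a completely bounded projection `B → S`. -/
def HasCBProjection {B : Type*} [NonUnitalCStarAlgebra B]
    (S : NonUnitalStarSubalgebra ℂ B) : Prop :=
  ∃ P : B →ₗ[ℂ] B, (∀ b, P b ∈ S) ∧ (∀ s ∈ S, P s = s) ∧ IsCompletelyBounded P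

section Hilbert

variable {H K : Type*} [NormedAddCommGroup H] [InnerProductSpace ℂ H]
  [NormedAddCommGroup K] [InnerProductSpace ℂ K]

variable (H K) in
/-- The Hilbert space tensor product: the completion of the algebraic tensor product for the inner
product with `⟪h ⊗ k, h' ⊗ k'⟫ = ⟪h, h'⟫ ⟪k, k'⟫`. -/
def HilbertTensor : Type _ := UniformSpace.Completion (H ⊗[ℂ] K)

instance : NormedAddCommGroup (HilbertTensor H K) :=
  inferInstanceAs (NormedAddCommGroup (UniformSpace.Completion (H ⊗[ℂ] K)))

instance : InnerProductSpace ℂ (HilbertTensor H K) :=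
  inferInstanceAs (InnerProductSpace ℂ (UniformSpace.Completion (H ⊗[ℂ] K)))

instance : CompleteSpace (HilbertTensor H K) :=
  inferInstanceAs (CompleteSpace (UniformSpace.Completion (H ⊗[ℂ] K)))

variable (H K) in
/-- The isometric inclusion of the algebraic tensor product into its completion. -/
def toHilbertTensor : H ⊗[ℂ] K →ₗᵢ[ℂ] HilbertTensor H K :=
  UniformSpace.Completion.toComplₗᵢ

theorem denseRange_toHilbertTensor : DenseRange (toHilbertTensor H K) :=
  UniformSpace.Completion.denseRange_coe

/-- The operator `S ⊗ T` on the Hilbert space tensor product. -/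
def opTensor (S : H →L[ℂ] H) (T : K →L[ℂ] K) :
    HilbertTensor H K →L[ℂ] HilbertTensor H K :=
  (TensorProduct.mapL S T).completion

theorem opTensor_coe (S : H →L[ℂ] H) (T : K →L[ℂ] K) (x : H ⊗[ℂ] K) :
    opTensor S T (toHilbertTensor H K x) = toHilbertTensor H K (TensorProduct.mapL S T x) :=
  ContinuousLinearMap.completion_apply_coe _ _

theorem ext_coe {S T : HilbertTensor H K →L[ℂ] HilbertTensor H K}
    (h : ∀ x, S (toHilbertTensor H K x) = T (toHilbertTensor H K x)) : S = T :=
  ContinuousLinearMap.coeFn_injective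
    (denseRange_toHilbertTensor.equalizer S.continuous T.continuous (funext h))

variable (H K) in
/-- The bilinear map `(S, T) ↦ S ⊗ T`. -/
def opTensorₗ : (H →L[ℂ] H) →ₗ[ℂ] (K →L[ℂ] K) →ₗ[ℂ]
    (HilbertTensor H K →L[ℂ] HilbertTensor H K) :=
  LinearMap.mk₂ ℂ opTensor
    (fun S S' T => ext_coe fun x => by
      simp only [add_apply, opTensor_coe, TensorProduct.mapL_add_left, map_add])
    (fun c S T => ext_coe fun x => by
      simp only [smul_apply, opTensor_coe, TensorProduct.mapL_smul_left, map_smul])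
    (fun S T T' => ext_coe fun x => by
      simp only [add_apply, opTensor_coe, TensorProduct.mapL_add_right, map_add])
    (fun c S T => ext_coe fun x => by
      simp only [smul_apply, opTensor_coe, TensorProduct.mapL_smul_right, map_smul])

end Hilbert

section MinTensor

variable {A B H K : Type*}
  [NormedAddCommGroup H] [InnerProductSpace ℂ H] [CompleteSpace H]
  [NormedAddCommGroup K] [InnerProductSpace ℂ K] [CompleteSpace K]
  [NonUnitalRing A] [Module ℂ A] [Star A] [NonUnitalRing B] [Module ℂ B] [Star B]

/-- The minimal (spatial) tensor product of two ⋆-algebras, given by faithful representations `π`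
and `ρ` on Hilbert spaces: the C⋆-algebra of operators on the Hilbert space tensor product
generated by the elementary tensors `π a ⊗ ρ b`. These span a ⋆-algebra, so this is also
their closed linear span. -/
def minTensor (π : A →⋆ₙₐ[ℂ] (H →L[ℂ] H)) (ρ : B →⋆ₙₐ[ℂ] (K →L[ℂ] K)) :
    NonUnitalStarSubalgebra ℂ (HilbertTensor H K →L[ℂ] HilbertTensor H K) :=
  (NonUnitalStarAlgebra.adjoin ℂ
    {T | ∃ (a : A) (b : B), T = opTensor (π a) (ρ b)}).topologicalClosure

/-- The linear map `a ⊗ b ↦ π a ⊗ ρ b` from the algebraic tensor product to operators. -/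
def tensorRep (π : A →⋆ₙₐ[ℂ] (H →L[ℂ] H)) (ρ : B →⋆ₙₐ[ℂ] (K →L[ℂ] K)) :
    A ⊗[ℂ] B →ₗ[ℂ] (HilbertTensor H K →L[ℂ] HilbertTensor H K) :=
  TensorProduct.lift
    ((opTensorₗ H K).compl₁₂ (π : A →ₗ[ℂ] (H →L[ℂ] H)) (ρ : B →ₗ[ℂ] (K →L[ℂ] K)))

theorem tensorRep_mem (π : A →⋆ₙₐ[ℂ] (H →L[ℂ] H)) (ρ : B →⋆ₙₐ[ℂ] (K →L[ℂ] K))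
    (x : A ⊗[ℂ] B) : tensorRep π ρ x ∈ minTensor π ρ := by
  induction x with
  | zero => simp only [map_zero, zero_mem]
  | add x y hx hy => simpa only [map_add] using add_mem hx hy
  | tmul a b =>
    exact NonUnitalStarSubalgebra.le_topologicalClosure _
      (NonUnitalStarAlgebra.subset_adjoin ℂ _ ⟨a, b, rfl⟩)

/-- The inclusion of the algebraic tensor product into the minimal tensor product. -/
def tensorIncl (π : A →⋆ₙₐ[ℂ] (H →L[ℂ] H)) (ρ : B →⋆ₙₐ[ℂ] (K →L[ℂ] K)) :
    A ⊗[ℂ] B →ₗ[ℂ] minTensor π ρ where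
  toFun x := ⟨tensorRep π ρ x, tensorRep_mem π ρ x⟩
  map_add' x y := Subtype.ext (map_add _ x y)
  map_smul' c x := Subtype.ext (map_smul _ c x)

end MinTensor

section Slice

variable {A B H K : Type*} [NonUnitalCStarAlgebra A] [NonUnitalCStarAlgebra B]
  [NormedAddCommGroup H] [InnerProductSpace ℂ H] [CompleteSpace H]
  [NormedAddCommGroup K] [InnerProductSpace ℂ K] [CompleteSpace K]

/-- The slice map `φ ⊗ id_B : A ⊗ B → B`, i.e. the continuous linear extension of
`a ⊗ b ↦ φ a • b` from the algebraic to the minimal tensor product. -/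
def slice (π : A →⋆ₙₐ[ℂ] (H →L[ℂ] H)) (ρ : B →⋆ₙₐ[ℂ] (K →L[ℂ] K)) (φ : A →L[ℂ] ℂ) :
    minTensor π ρ →L[ℂ] B :=
  ((TensorProduct.lid ℂ B).toLinearMap ∘ₗ
    LinearMap.rTensor B (φ : A →ₗ[ℂ] ℂ)).extendOfNorm (tensorIncl π ρ)

/-- The set of all slices `(φ ⊗ id_B)(c)`, for `φ` in the dual of `A` and `c` in `C`. -/
def sliceSet (π : A →⋆ₙₐ[ℂ] (H →L[ℂ] H)) (ρ : B →⋆ₙₐ[ℂ] (K →L[ℂ] K))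
    (C : NonUnitalStarSubalgebra ℂ (HilbertTensor H K →L[ℂ] HilbertTensor H K)) : Set B :=
  {b | ∃ (φ : A →L[ℂ] ℂ) (c : minTensor π ρ),
    (c : HilbertTensor H K →L[ℂ] HilbertTensor H K) ∈ C ∧ slice π ρ φ c = b}

/-- The map `φ ⊗ id_B` on `A ⊗ B`, for a linear map `φ` on `A`: the continuous linear extension
of `a ⊗ b ↦ φ a ⊗ b`. It is used for `φ` bounded of finite rank, where the extension exists. -/
def amplify (π : A →⋆ₙₐ[ℂ] (H →L[ℂ] H)) (ρ : B →⋆ₙₐ[ℂ] (K →L[ℂ] K)) (φ : A →L[ℂ] A) :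
    minTensor π ρ →L[ℂ] (HilbertTensor H K →L[ℂ] HilbertTensor H K) :=
  (tensorRep π ρ ∘ₗ LinearMap.rTensor B (φ : A →ₗ[ℂ] A)).extendOfNorm (tensorIncl π ρ)

/-- The Hilbert space `ℓ²(ℕ)`. -/
abbrev ellTwo : Type := lp (fun _ : ℕ => ℂ) 2

/-- The strong operator approximation property of a C⋆-algebra `A`, given by a faithful
representation: there is a net of bounded finite-rank linear maps `φ` on `A` such that
`φ ⊗ id → id` in the point-norm topology on `A ⊗ B(ℓ²)`. The net is encoded by a proper filter. -/
def HasSOAP (π : A →⋆ₙₐ[ℂ] (H →L[ℂ] H)) : Prop :=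
  ∃ l : Filter (A →L[ℂ] A), l.NeBot ∧
    (∀ᶠ φ : A →L[ℂ] A in l, FiniteDimensional ℂ (φ : A →ₗ[ℂ] A).range) ∧
    ∀ x : minTensor π (NonUnitalStarAlgHom.id ℂ (ellTwo →L[ℂ] ellTwo)),
      Filter.Tendsto
        (fun φ => amplify π (NonUnitalStarAlgHom.id ℂ (ellTwo →L[ℂ] ellTwo)) φ x) l
        (nhds (x : HilbertTensor H ellTwo →L[ℂ] HilbertTensor H ellTwo))

end Slice

end TensorSplitting

end

open scoped TensorProduct

noncomputable section

namespace TensorSplitting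

/-! ### Sums of squares in a right ideal, and cutting down by functional calculus. -/

section SquareSums

variable {A : Type*} [NonUnitalCStarAlgebra A]

/-! The heart of the matter is that `a ⊗ s ∈ C` whenever `s` is a slice of some `c ∈ C`. By
Hahn–Banach it is enough that every functional `f` vanishing on `C` vanishes at `a ⊗ s`, and since
`A` is spanned by the elements `d d⋆`, one may take `a = d d⋆`. Put `ψ = f(a ⊗ ·)`. By the Fubini
identity `ψ((φ ⊗ id)(c)) = φ((id ⊗ ψ)(c))`, the claim becomes `(id ⊗ ψ)(c) = 0`.

Simplicity supplies averaging maps `S(x) = ∑ u⋆ x u` that send finitely many prescribed self-adjoint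
`x` close to scalar multiples `l(x) a` (`exists_averaging`). They come from excision: inside any
nonzero right ideal there is a nonzero `w` on which the given elements act almost as scalars. By
simplicity `a` is a limit of sums `∑ (w v)⋆ (w v)`, so one can take `u = w v`. Now suppose `(id ⊗
ψ)(c) = y ≠ 0`. Replacing `c` by `(y⋆ ⊗ 1)c` makes the slice the positive element `g = y⋆ y`. If `c
≈ ∑ x_j ⊗ b_j`, then `(S ⊗ id)(c) ≈ ∑ l(x_j) a ⊗ b_j` still lies near `C`, so applying `f` gives `L
= ∑ l(x_j) ψ(b_j) ≈ 0`. On the other hand `S(g) ≈ ∑ ψ(b_j) S(x_j) ≈ L a`, so `S(g)` is small. But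
`w` can be chosen so that `‖S(g)‖` is at least about `‖g‖ ‖a‖ / 2`, a contradiction.

Hence the slices of `C` are exactly the `b` with `A ⊗ b ⊆ C`, a condition that defines a
C⋆-subalgebra `S` (if `A = 0`, take `S = 0`). Equality `C = A ⊗ S` is then a slice map property: an
element of `A ⊗ B` with all slices in `S` must lie in `A ⊗ S`. A completely bounded projection `P`
extends to `id ⊗ P`, which maps into `A ⊗ S` and fixes such elements because slices separate points.
Under the approximation property, `(φ_i ⊗ id)(c)` lies in `A ⊗ S`. The slices of one `c` form a
separable set, so the convergence to `c` can be checked after compressing `K` to `ℓ²`, where the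
hypothesis applies. -/

/-- The sums `∑ (w v)⋆ (w v)`. -/
def squareSums (w : A) : Set A :=
  {b | ∃ (ι : Type) (_ : Fintype ι) (v : ι → A), b = ∑ i, star (w * v i) * (w * v i)}

theorem conj_mem_squareSums {w b : A} (hb : b ∈ squareSums w) (z : A) :
    star z * b * z ∈ squareSums w := by
  obtain ⟨ι, _, v, rfl⟩ := hb
  refine ⟨ι, inferInstance, fun i => v i * z, ?_⟩
  simp only [Finset.mul_sum, Finset.sum_mul, star_mul, mul_assoc]

theorem add_mem_squareSums {w b c : A} (hb : b ∈ squareSums w) (hc : c ∈ squareSums w) :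
    b + c ∈ squareSums w := by
  obtain ⟨ι, _, v, rfl⟩ := hb
  obtain ⟨κ, _, u, rfl⟩ := hc
  exact ⟨ι ⊕ κ, inferInstance, Sum.elim v u, by simp⟩

theorem smul_mem_squareSums {w b : A} (hb : b ∈ squareSums w) {r : ℝ} (hr : 0 ≤ r) :
    r • b ∈ squareSums w := by
  obtain ⟨ι, _, v, rfl⟩ := hb
  refine ⟨ι, inferInstance, fun i => Real.sqrt r • v i, ?_⟩
  simp only [Finset.smul_sum, mul_smul_comm, star_smul, smul_mul_assoc, smul_smul, star_trivial,
    Real.mul_self_sqrt hr]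

/-- This is `(1 - κ(b)) b (1 - κ(b))` multiplied out, because `A` need not have a unit. -/
theorem conj_one_sub_cfcₙ {b : A} (hb : IsSelfAdjoint b) {κ : ℝ → ℝ} (hκ : Continuous κ)
    (hκ0 : κ 0 = 0) :
    b - cfcₙ κ b * b - b * cfcₙ κ b + cfcₙ κ b * b * cfcₙ κ b
      = cfcₙ (fun t => t * (1 - κ t) ^ 2) b := by
  have hc : ∀ {f : ℝ → ℝ}, Continuous f → ContinuousOn f (quasispectrum ℝ b) :=
    fun h => h.continuousOn
  have hid : cfcₙ (fun t : ℝ => t) b = b := cfcₙ_id' ℝ b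
  have h1 : cfcₙ (fun t => κ t * t) b = cfcₙ κ b * b := by
    rw [cfcₙ_mul κ _ b (hc hκ) hκ0 (hc (f := fun t => t) continuous_id) rfl, hid]
  have h2 : cfcₙ (fun t => t * κ t) b = b * cfcₙ κ b := by
    rw [cfcₙ_mul _ κ b (hc (f := fun t => t) continuous_id) rfl (hc hκ) hκ0, hid]
  have h3 : cfcₙ (fun t => κ t * t * κ t) b = cfcₙ κ b * b * cfcₙ κ b := by
    rw [cfcₙ_mul (fun t => κ t * t) κ b (hc (by fun_prop)) (by simp) (hc hκ) hκ0, h1]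
  have h4 : (fun t => t * (1 - κ t) ^ 2)
      = fun t => t - κ t * t - t * κ t + κ t * t * κ t := by ext t; ring
  rw [h4, cfcₙ_add (fun t => t - κ t * t - t * κ t) (fun t => κ t * t * κ t) b (hc (by fun_prop))
      (by simp) (hc (by fun_prop)) (by simp),
    cfcₙ_sub (fun t => t - κ t * t) (fun t => t * κ t) b (hc (by fun_prop)) (by simp)
      (hc (by fun_prop)) (by simp),
    cfcₙ_sub (fun t => t) (fun t => κ t * t) b (hc (by fun_prop)) (by simp)
      (hc (by fun_prop)) (by simp), hid, h1, h2, h3]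

end SquareSums

/-! ### Excision and averaging in simple C⋆-algebras. -/

section CStar

variable {A : Type*} [NonUnitalCStarAlgebra A] [PartialOrder A] [StarOrderedRing A]

/-- If `v⋆ x v ≤ m v⋆ v` fails, then the reverse inequality holds after cutting `v` down. -/
theorem exists_mul_ne_zero_of_not_le {v x : A} (hx : IsSelfAdjoint x) {m : ℝ}
    (h : ¬ star v * x * v ≤ m • (star v * v)) :
    ∃ z, v * z ≠ 0 ∧ m • (star (v * z) * (v * z)) ≤ star (v * z) * x * (v * z) := by
  set k : A := star v * x * v - m • (star v * v) with hk
  have hksa : IsSelfAdjoint k := by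
    refine IsSelfAdjoint.sub ?_ ?_
    · simp [IsSelfAdjoint, mul_assoc, hx.star_eq]
    · exact (IsSelfAdjoint.all m).smul (.star_mul_self v)
  have hz : IsSelfAdjoint k⁺ := (CFC.posPart_nonneg k).isSelfAdjoint
  have hkk : k⁺ * k = k⁺ * k⁺ := by
    have h := congrArg (k⁺ * ·) (CFC.posPart_sub_negPart k hksa)
    simpa only [mul_sub, CFC.posPart_mul_negPart, sub_zero] using h.symm
  have hgen : ∀ z : A, IsSelfAdjoint z →
      star (v * z) * x * (v * z) - m • (star (v * z) * (v * z)) = z * k * z := by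
    intro z hz
    simp only [hk, star_mul, hz.star_eq, mul_sub, sub_mul, mul_assoc, mul_smul_comm,
      smul_mul_assoc]
  have hconj : star (v * k⁺) * x * (v * k⁺) - m • (star (v * k⁺) * (v * k⁺))
      = k⁺ * k⁺ * k⁺ := by
    rw [← hkk, hgen _ hz]
  -- Conjugating `k` by its positive part leaves `(k⁺)³ ≥ 0`. If `v k⁺` were zero, this cube would
  -- vanish, hence `k⁺ = 0` and `k ≤ 0`.
  refine ⟨k⁺, fun h0 => h ?_, ?_⟩
  · rw [h0] at hconj
    simp only [star_zero, zero_mul, mul_zero, smul_zero, sub_zero] at hconj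
    have h1 : star (k⁺ * k⁺) * (k⁺ * k⁺) = 0 := by
      rw [star_mul, hz.star_eq, ← mul_assoc, ← hconj, zero_mul]
    have h2 : star k⁺ * k⁺ = 0 := by
      rw [hz.star_eq]; exact CStarRing.star_mul_self_eq_zero_iff _ |>.1 h1
    have h3 : k⁺ = 0 := CStarRing.star_mul_self_eq_zero_iff _ |>.1 h2
    have h4 : k ≤ 0 := by
      rw [← CFC.posPart_sub_negPart k hksa, h3, zero_sub]
      exact neg_nonpos.2 (CFC.negPart_nonneg k)
    exact sub_nonpos.1 h4
  · rw [← sub_nonneg, hconj]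
    have := star_left_conjugate_nonneg (CFC.posPart_nonneg k) k⁺
    rwa [hz.star_eq] at this

theorem neg_norm_smul_le_star_left_conjugate {x : A} (hx : IsSelfAdjoint x) (v : A) :
    -(‖x‖ • (star v * v)) ≤ star v * x * v := by
  have := CStarAlgebra.star_left_conjugate_le_norm_smul (a := v) (b := -x) (hb := hx.neg)
  rw [norm_neg, mul_neg, neg_mul] at this
  exact neg_le.1 this

/-- In the right ideal generated by a nonzero element one finds a nonzero `w` for which finitely
many prescribed self-adjoint elements act as scalars, up to `ε`. -/
theorem exists_excising {v : A} (hv : v ≠ 0) (s : Finset A) (hs : ∀ x ∈ s, IsSelfAdjoint x)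
    {ε : ℝ} (hε : 0 < ε) :
    ∃ (z : A) (l : A → ℝ), v * z ≠ 0 ∧ ∀ x ∈ s,
      l x • (star (v * z) * (v * z)) ≤ star (v * z) * x * (v * z) ∧
      star (v * z) * x * (v * z) ≤ (l x + ε) • (star (v * z) * (v * z)) := by
  classical
  induction s using Finset.induction_on with
  | empty =>
    -- Without a unit, `v⋆` serves as the factor that keeps `v z` nonzero.
    exact ⟨star v, fun _ => 0, fun h => hv (CStarRing.mul_star_self_eq_zero_iff v |>.1 h), by simp⟩
  | insert x s hxs ih =>
    obtain ⟨z, l, hz, hl⟩ := ih fun y hy => hs y (Finset.mem_insert_of_mem hy)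
    have hx := hs x (Finset.mem_insert_self _ _)
    set w := v * z with hw
    -- `P m` says that `x` is bounded above by `m` on the right ideal `w A`. Lowering `m` from `‖x‖`
    -- in steps of `ε`, the first failure allows cutting down to where `x ≥ m`, while the bound `m +
    -- ε` one step earlier still holds on all of `w A`.
    let P : ℝ → Prop := fun m => ∀ y, star (w * y) * x * (w * y) ≤ m • (star (w * y) * (w * y))
    have hP0 : P ‖x‖ := fun y => CStarAlgebra.star_left_conjugate_le_norm_smul hx
    have hPn : ∀ m, m < -‖x‖ → ¬ P m := by
      intro m hm h
      have hy : w * star w ≠ 0 := fun h => hz (CStarRing.mul_star_self_eq_zero_iff w |>.1 h)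
      have h1 := (neg_norm_smul_le_star_left_conjugate hx (w * star w)).trans (h (star w))
      set g := star (w * star w) * (w * star w)
      have h2 : (-‖x‖ - m) • g ≤ 0 := by
        rw [sub_smul, neg_smul]; exact sub_nonpos.2 h1
      have h3 : g ≤ 0 := by
        have := smul_le_smul_of_nonneg_left h2 (inv_nonneg.2 (by linarith : 0 ≤ -‖x‖ - m))
        rwa [smul_zero, smul_smul, inv_mul_cancel₀ (by linarith), one_smul] at this
      have h4 : g = 0 := le_antisymm h3 (star_mul_self_nonneg _)
      exact hy (CStarRing.star_mul_self_eq_zero_iff _ |>.1 h4)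
    have hex : ∃ n : ℕ, ¬ P (‖x‖ - n * ε) := by
      obtain ⟨n, hn⟩ := exists_nat_gt (2 * ‖x‖ / ε)
      refine ⟨n, hPn _ ?_⟩
      rw [div_lt_iff₀ hε] at hn
      linarith
    obtain ⟨n, hn, hmin⟩ : ∃ n : ℕ, ¬ P (‖x‖ - n * ε) ∧ ∀ k < n, P (‖x‖ - k * ε) :=
      ⟨Nat.find hex, Nat.find_spec hex, fun k hk => not_not.1 (Nat.find_min hex hk)⟩
    obtain _ | n := n
    · exact absurd hP0 (by simpa using hn)
    have hup := hmin n (Nat.lt_succ_self n)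
    obtain ⟨y, hy⟩ := not_forall.1 hn
    obtain ⟨z', hz', hlow⟩ := exists_mul_ne_zero_of_not_le hx hy
    set m : ℝ := ‖x‖ - ((n + 1 : ℕ) : ℝ) * ε with hm
    have hassoc : v * (z * (y * z')) = w * y * z' := by simp only [hw, mul_assoc]
    refine ⟨z * (y * z'), fun a => if a = x then m else l a, ?_, ?_⟩
    · rwa [hassoc]
    · intro a ha
      rw [hassoc]
      by_cases hax : a = x
      · subst hax
        simp only [if_true]
        refine ⟨hlow, ?_⟩
        have := hup (y * z')
        rw [← mul_assoc w] at this
        convert this using 2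
        rw [hm]; push_cast; ring
      · simp only [hax, if_false]
        have has : a ∈ s := (Finset.mem_insert.1 ha).resolve_left hax
        obtain ⟨h1, h2⟩ := hl a has
        -- Passing to a smaller right ideal only conjugates the earlier estimates, so they survive.
        have e1 : star (w * y * z') * a * (w * y * z')
            = star (y * z') * (star w * a * w) * (y * z') := by simp only [star_mul, mul_assoc]
        have e2 : star (w * y * z') * (w * y * z')
            = star (y * z') * (star w * w) * (y * z') := by simp only [star_mul, mul_assoc]
        have h1' := star_left_conjugate_le_conjugate h1 (y * z')
        have h2' := star_left_conjugate_le_conjugate h2 (y * z')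
        rw [mul_smul_comm, smul_mul_assoc] at h1' h2'
        rw [e1, e2]
        exact ⟨h1', h2'⟩

theorem star_add_mul_add_le (x y : A) :
    star (x + y) * (x + y) ≤ (2 : ℝ) • (star x * x) + (2 : ℝ) • (star y * y) := by
  rw [← sub_nonneg]
  convert star_mul_self_nonneg (x - y) using 1
  simp only [star_add, star_sub, mul_add, add_mul, mul_sub, sub_mul, two_smul]
  abel

/-- For a generator `D = p w⋆ w q`, the square `D⋆ D` is the conjugate by `w q` of `(p w⋆)⋆ (p w⋆)`,
which is bounded by its norm. Sums cost a factor `2`, scalars a factor `‖a‖²`. -/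
theorem exists_squareSums_ge {w D : A}
    (hD : D ∈ Submodule.span ℂ {y | ∃ p q : A, y = p * (star w * w) * q}) :
    ∃ b ∈ squareSums w, star D * D ≤ b := by
  induction hD using Submodule.span_induction with
  | mem y hy =>
    obtain ⟨p, q, rfl⟩ := hy
    refine ⟨‖star (p * star w) * (p * star w)‖ • (star (w * q) * (w * q)), ?_, ?_⟩
    · exact smul_mem_squareSums ⟨Unit, inferInstance, fun _ => q, by simp⟩ (norm_nonneg _)
    · have := CStarAlgebra.star_left_conjugate_le_norm_smul (a := w * q)
        (b := star (p * star w) * (p * star w)) (hb := .star_mul_self _)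
      simpa only [star_mul, star_star, mul_assoc] using this
  | zero => exact ⟨0, ⟨Empty, inferInstance, Empty.elim, by simp⟩, by simp⟩
  | add x y _ _ hx hy =>
    obtain ⟨b, hb, hxb⟩ := hx
    obtain ⟨c, hc, hyc⟩ := hy
    refine ⟨(2 : ℝ) • b + (2 : ℝ) • c, add_mem_squareSums (smul_mem_squareSums hb zero_le_two)
      (smul_mem_squareSums hc zero_le_two), (star_add_mul_add_le x y).trans ?_⟩
    gcongr
  | smul a x _ hx =>
    obtain ⟨b, hb, hxb⟩ := hx
    refine ⟨(‖a‖ ^ 2) • b, smul_mem_squareSums hb (sq_nonneg _), ?_⟩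
    have : star (a • x) * (a • x) = (‖a‖ ^ 2) • (star x * x) := by
      rw [star_smul, smul_mul_assoc, mul_smul_comm, smul_smul, ← Complex.coe_smul]
      congr 1
      rw [Complex.star_def, ← Complex.normSq_eq_conj_mul_self, Complex.normSq_eq_norm_sq]
    rw [this]
    gcongr

/-- Unit-free form of conjugating `X ≤ b` by `1 - e`: if `b - X = y⋆ y`, the difference of the two
sides is `(y - y e)⋆ (y - y e)`. -/
theorem conj_one_sub_le {X b e : A} (he : IsSelfAdjoint e) (h : X ≤ b) :
    X - e * X - X * e + e * X * e ≤ b - e * b - b * e + e * b * e := by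
  obtain ⟨y, hy⟩ := CStarAlgebra.nonneg_iff_eq_star_mul_self.1 (sub_nonneg.2 h)
  rw [← sub_nonneg]
  convert star_mul_self_nonneg (y - y * e) using 1
  have hb : b = X + star y * y := by rw [← hy]; abel
  rw [hb]
  simp only [star_sub, star_mul, he.star_eq, mul_add, add_mul, mul_sub, sub_mul, mul_assoc]
  abel

/-- If `D⋆ D ≤ b`, then `D` is a limit of elements `y` with `y y⋆ = z⋆ b z`. -/
theorem exists_mul_star_eq_conj {D b : A} (h : star D * D ≤ b) {δ : ℝ} (hδ : 0 < δ) :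
    ∃ y z : A, ‖D - y‖ ^ 2 ≤ δ ∧ y * star y = star z * b * z := by
  have hb : 0 ≤ b := (star_mul_self_nonneg D).trans h
  -- On `t ≥ 0` these satisfy `t f² = κ²` and `t (1 - κ)² = t δ² / (t + δ)² ≤ δ`. The first identity
  -- gives `y y⋆ = z⋆ b z`, the second bounds the error. The absolute values make both functions
  -- continuous on all of `ℝ`.
  let f : ℝ → ℝ := fun t => Real.sqrt |t| / (|t| + δ)
  let κ : ℝ → ℝ := fun t => |t| / (|t| + δ)
  have hne : ∀ t : ℝ, |t| + δ ≠ 0 := fun t => by positivity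
  have hf : Continuous f := by fun_prop (disch := exact hne _)
  have hκ : Continuous κ := by fun_prop (disch := exact hne _)
  have hf0 : f 0 = 0 := by simp [f]
  have hκ0 : κ 0 = 0 := by simp [κ]
  set s := cfcₙ f b
  set e := cfcₙ κ b
  have hs : IsSelfAdjoint s := cfcₙ_predicate f b
  have he : IsSelfAdjoint e := cfcₙ_predicate κ b
  have hbsa : IsSelfAdjoint b := hb.isSelfAdjoint
  have hid : cfcₙ (fun t : ℝ => t) b = b := cfcₙ_id' ℝ b
  have hsbs : s * b * s = e * e := by
    conv_lhs => rw [← hid]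
    rw [← cfcₙ_mul f _ b, ← cfcₙ_mul _ f b, ← cfcₙ_mul κ κ b]
    refine cfcₙ_congr fun t ht => ?_
    have ht0 : 0 ≤ t := quasispectrum_nonneg_of_nonneg b hb t ht
    simp only [f, κ, abs_of_nonneg ht0]
    have := Real.mul_self_sqrt ht0
    have h2 : t + δ ≠ 0 := by positivity
    field_simp
    rw [sq, this]; ring
  refine ⟨D * e, s * star D, ?_, ?_⟩
  · have h1 : star (D - D * e) * (D - D * e)
        = star D * D - e * (star D * D) - (star D * D) * e + e * (star D * D) * e := by
      simp only [star_sub, star_mul, he.star_eq, mul_sub, sub_mul, mul_assoc]; abel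
    have h2 := conj_one_sub_cfcₙ hbsa hκ hκ0
    rw [sq, ← CStarRing.norm_star_mul_self, h1]
    refine (CStarAlgebra.norm_le_norm_of_nonneg_of_le ?_ (conj_one_sub_le he h)).trans ?_
    · rw [← h1]; exact star_mul_self_nonneg _
    · rw [h2]
      refine norm_cfcₙ_le fun t ht => ?_
      have ht0 : 0 ≤ t := quasispectrum_nonneg_of_nonneg b hb t ht
      have h4 : 1 - κ t = δ / (t + δ) := by
        simp only [κ, abs_of_nonneg ht0]; field_simp; ring
      rw [h4, Real.norm_of_nonneg (by positivity), div_pow, ← mul_div_assoc,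
        div_le_iff₀ (by positivity)]
      nlinarith [mul_nonneg ht0 hδ.le, mul_nonneg (sq_nonneg t) hδ.le]
  · simp only [star_mul, star_star, hs.star_eq, he.star_eq]
    calc D * e * (e * star D) = D * (e * e) * star D := by simp only [mul_assoc]
      _ = D * (s * b * s) * star D := by rw [hsbs]
      _ = _ := by simp only [mul_assoc]

/-- In a simple C⋆-algebra, every `d d⋆` is a limit of sums `∑ (w v)⋆ (w v)`. -/
theorem mul_star_mem_closure_squareSums (hA : IsSimple A) {w : A} (hw : w ≠ 0) (d : A) :
    d * star d ∈ closure (squareSums w) := by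
  let J : Submodule ℂ A := Submodule.span ℂ {y | ∃ p q : A, y = p * (star w * w) * q}
  have hJ : ∀ a x : A, x ∈ J → a * x ∈ J ∧ x * a ∈ J := by
    intro a x hx
    induction hx using Submodule.span_induction with
    | mem y hy =>
      obtain ⟨p, q, rfl⟩ := hy
      exact ⟨Submodule.subset_span ⟨a * p, q, by simp only [mul_assoc]⟩,
        Submodule.subset_span ⟨p, q * a, by simp only [mul_assoc]⟩⟩
    | zero => simp
    | add x y _ _ hx hy =>
      exact ⟨by rw [mul_add]; exact add_mem hx.1 hy.1, by rw [add_mul]; exact add_mem hx.2 hy.2⟩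
    | smul c x _ hx =>
      exact ⟨by rw [mul_smul_comm]; exact J.smul_mem c hx.1,
        by rw [smul_mul_assoc]; exact J.smul_mem c hx.2⟩
  have hd : d ∈ closure (J : Set A) := by
    have := hA J.topologicalClosure J.isClosed_topologicalClosure fun a x hx =>
      ⟨map_mem_closure (continuous_const_mul a) hx fun y hy => (hJ a y hy).1,
        map_mem_closure (f := fun y => y * a) (continuous_mul_const a) hx fun y hy => (hJ a y hy).2⟩
    rcases this with h | h
    -- The ideal contains `(w⋆ w)³`, which is nonzero together with `w`.
    · exfalso
      set g := star w * w with hg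
      have hgsa : IsSelfAdjoint g := .star_mul_self w
      have hmem : g * g * g ∈ J.topologicalClosure :=
        J.le_topologicalClosure (Submodule.subset_span ⟨g, g, rfl⟩)
      rw [h, Submodule.mem_bot] at hmem
      have h1 : star (g * g) * (g * g) = 0 := by
        rw [star_mul, hgsa.star_eq, ← mul_assoc, hmem, zero_mul]
      have h2 : star g * g = 0 := by
        rw [hgsa.star_eq]; exact CStarRing.star_mul_self_eq_zero_iff _ |>.1 h1
      have h3 : g = 0 := CStarRing.star_mul_self_eq_zero_iff _ |>.1 h2
      exact hw (CStarRing.star_mul_self_eq_zero_iff _ |>.1 h3)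
    · have : d ∈ J.topologicalClosure := h ▸ Submodule.mem_top
      exact this
  -- Working with `y` instead of `y y⋆` lets the closure pass through the continuous map `y ↦ y y⋆`.
  let Y : Set A := {y | y * star y ∈ squareSums w}
  have hJY : (J : Set A) ⊆ closure Y := by
    intro D hD
    obtain ⟨b, hb, hDb⟩ := exists_squareSums_ge hD
    refine Metric.mem_closure_iff.2 fun ε hε => ?_
    obtain ⟨y, z, hy, hyz⟩ := exists_mul_star_eq_conj hDb (δ := (ε / 2) ^ 2) (by positivity)
    refine ⟨y, ?_, ?_⟩
    · rw [Set.mem_ofPred_eq]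
      rw [hyz]; exact conj_mem_squareSums hb z
    · rw [dist_eq_norm]
      have := abs_le_of_sq_le_sq' hy (by positivity)
      linarith [this.2]
  have hdY : d ∈ closure Y := closure_minimal hJY isClosed_closure hd
  exact map_mem_closure (f := fun y : A => y * star y) (by fun_prop) hdY fun y hy => hy

/-- The inequality would give `‖h‖⁴ = ‖h⁴‖ ≤ ‖h‖ ‖h³‖ ≤ ‖h‖⁴ / 2`. It starts the excision in a right
ideal where `h` is at least `‖h‖ / 2`. -/
theorem not_conj_self_le {h : A} (hh : 0 ≤ h) (h0 : h ≠ 0) :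
    ¬ star h * h * h ≤ (‖h‖ / 2) • (star h * h) := by
  intro hle
  have hsa : star h = h := hh.isSelfAdjoint.star_eq
  have hpos : 0 < ‖h‖ := norm_pos_iff.2 h0
  have h1 : ‖star h * h‖ = ‖h‖ * ‖h‖ := CStarRing.norm_star_mul_self
  have h2 : ‖star (h * h) * (h * h)‖ = ‖h * h‖ * ‖h * h‖ := CStarRing.norm_star_mul_self
  rw [hsa] at h1 hle
  rw [star_mul, hsa, h1] at h2
  have h3 : ‖h * h * h‖ ≤ ‖h‖ / 2 * (‖h‖ * ‖h‖) := by
    have h4 : 0 ≤ h * h * h := by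
      have := star_left_conjugate_nonneg hh h
      rwa [hsa] at this
    have := CStarAlgebra.norm_le_norm_of_nonneg_of_le h4 hle
    rwa [norm_smul, h1, Real.norm_of_nonneg (by positivity)] at this
  have h5 : ‖h * h * (h * h)‖ ≤ ‖h‖ * ‖h * h * h‖ := by
    rw [mul_assoc h h (h * h), ← mul_assoc h h h]
    exact norm_mul_le _ _
  nlinarith [mul_pos (mul_pos hpos hpos) (mul_pos hpos hpos),
    mul_le_mul_of_nonneg_left h3 hpos.le]

theorem norm_sub_smul_le_of_le {g y : A} {l ε : ℝ} (hε : 0 ≤ ε) (h1 : l • g ≤ y)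
    (h2 : y ≤ (l + ε) • g) : ‖y - l • g‖ ≤ ε * ‖g‖ := by
  have h3 : y - l • g ≤ ε • g := by
    rw [add_smul] at h2
    exact sub_le_iff_le_add'.2 h2
  refine (CStarAlgebra.norm_le_norm_of_nonneg_of_le (sub_nonneg.2 h1) h3).trans ?_
  rw [norm_smul, Real.norm_of_nonneg hε]

/-- In a simple C⋆-algebra there are completely positive maps `x ↦ ∑ u⋆ x u` that are close to
`x ↦ l x • d d⋆` on finitely many self-adjoint elements, with `l h` bounded below for a given
positive `h`. -/
theorem exists_averaging (hA : IsSimple A) {h : A} (hh : 0 ≤ h) (h0 : h ≠ 0) (s : Finset A)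
    (hs : ∀ x ∈ s, IsSelfAdjoint x) (d : A) {ε : ℝ} (hε : 0 < ε) :
    ∃ (ι : Type) (_ : Fintype ι) (u : ι → A) (l : A → ℝ),
      ‖∑ i, star (u i) * u i - d * star d‖ ≤ ε ∧
      (‖h‖ / 2) • ∑ i, star (u i) * u i ≤ ∑ i, star (u i) * h * u i ∧
      ∀ x ∈ s, ‖∑ i, star (u i) * x * u i - l x • (d * star d)‖ ≤ ε := by
  obtain ⟨z₀, hz₀, hlow⟩ :=
    exists_mul_ne_zero_of_not_le hh.isSelfAdjoint (not_conj_self_le hh h0)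
  set a := d * star d with ha
  -- The sum `g` below has norm at most `‖a‖ + 1`, so this tolerance contributes at most `ε / 2`.
  -- The other half comes from `‖g - a‖`, multiplied by `|l x| ≤ t`.
  obtain ⟨z, l, hw, hl⟩ :=
    exists_excising hz₀ s hs (ε := ε / (2 * (‖a‖ + 1))) (by positivity)
  set w := h * z₀ * z with hwdef
  let t : ℝ := 1 + ∑ x ∈ s, |l x|
  have ht : 0 < t := by positivity
  obtain ⟨b, hb, hdist⟩ := Metric.mem_closure_iff.1 (mul_star_mem_closure_squareSums hA hw d)
    (min 1 (min ε (ε / (2 * t)))) (by positivity)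
  obtain ⟨ι, _, v, rfl⟩ := hb
  rw [dist_comm, dist_eq_norm, lt_min_iff, lt_min_iff, ← ha] at hdist
  obtain ⟨hd1, hd2, hd3⟩ := hdist
  set g := ∑ i, star (w * v i) * (w * v i) with hg
  have hgn : ‖g‖ ≤ ‖a‖ + 1 := by
    have := norm_le_norm_add_norm_sub' g a
    linarith
  refine ⟨ι, inferInstance, fun i => w * v i, l, hd2.le, ?_, fun x hx => ?_⟩
  · rw [Finset.smul_sum]
    refine Finset.sum_le_sum fun i _ => ?_
    have := star_left_conjugate_le_conjugate hlow (z * v i)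
    rw [mul_smul_comm, smul_mul_assoc] at this
    simpa only [hwdef, star_mul, mul_assoc] using this
  · have h1 : ‖∑ i, star (w * v i) * x * (w * v i) - l x • g‖ ≤ ε / (2 * (‖a‖ + 1)) * ‖g‖ := by
      refine norm_sub_smul_le_of_le (by positivity) ?_ ?_
      · rw [hg, Finset.smul_sum]
        refine Finset.sum_le_sum fun i _ => ?_
        have := star_left_conjugate_le_conjugate (hl x hx).1 (v i)
        rw [mul_smul_comm, smul_mul_assoc] at this
        simpa only [star_mul, mul_assoc] using this
      · rw [hg, Finset.smul_sum]
        refine Finset.sum_le_sum fun i _ => ?_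
        have := star_left_conjugate_le_conjugate (hl x hx).2 (v i)
        rw [mul_smul_comm, smul_mul_assoc] at this
        simpa only [star_mul, mul_assoc] using this
    have h2 : ‖l x • g - l x • a‖ ≤ t * (ε / (2 * t)) := by
      rw [← smul_sub, norm_smul]
      refine mul_le_mul ?_ hd3.le (norm_nonneg _) ht.le
      have := Finset.single_le_sum (f := fun x => |l x|) (fun _ _ => abs_nonneg _) hx
      rw [Real.norm_eq_abs]
      simp only [t]
      linarith
    have h3 : ε / (2 * (‖a‖ + 1)) * ‖g‖ ≤ ε / 2 := by
      calc ε / (2 * (‖a‖ + 1)) * ‖g‖ ≤ ε / (2 * (‖a‖ + 1)) * (‖a‖ + 1) := by gcongr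
        _ = ε / 2 := by field_simp
    have h4 : t * (ε / (2 * t)) = ε / 2 := by field_simp
    have h5 := norm_sub_le_norm_sub_add_norm_sub
      (∑ i, star (w * v i) * x * (w * v i)) (l x • g) (l x • a)
    linarith

end CStar

/-! ### Operators on the Hilbert space tensor product. -/

section HilbertTensor

open scoped InnerProductSpace

variable {H K : Type*} [NormedAddCommGroup H] [InnerProductSpace ℂ H]
  [NormedAddCommGroup K] [InnerProductSpace ℂ K]

theorem norm_opTensor_le (S : H →L[ℂ] H) (T : K →L[ℂ] K) : ‖opTensor S T‖ ≤ ‖S‖ * ‖T‖ := by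
  refine ContinuousLinearMap.opNorm_le_bound _ (by positivity) fun y => ?_
  refine denseRange_toHilbertTensor.induction_on (p := fun y => ‖opTensor S T y‖ ≤ ‖S‖ * ‖T‖ * ‖y‖)
    y (isClosed_le (by fun_prop) (by fun_prop)) fun x => ?_
  rw [opTensor_coe, LinearIsometry.norm_map, LinearIsometry.norm_map]
  exact (ContinuousLinearMap.le_opNorm _ _).trans (by gcongr; exact TensorProduct.norm_mapL_le S T)

/-- The continuous linear map `S ↦ S ⊗ T`. -/
def opTensorLeft (T : K →L[ℂ] K) :
    (H →L[ℂ] H) →L[ℂ] (HilbertTensor H K →L[ℂ] HilbertTensor H K) :=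
  ((opTensorₗ H K).flip T).mkContinuous ‖T‖ fun S => by
    rw [mul_comm]; exact norm_opTensor_le S T

theorem opTensorLeft_apply (S : H →L[ℂ] H) (T : K →L[ℂ] K) :
    opTensorLeft T S = opTensor S T := rfl

theorem opTensor_mul (S S' : H →L[ℂ] H) (T T' : K →L[ℂ] K) :
    opTensor S T * opTensor S' T' = opTensor (S * S') (T * T') :=
  ext_coe fun x => by
    rw [mul_apply_eq_comp, opTensor_coe, opTensor_coe, opTensor_coe,
      TensorProduct.mapL_mul, mul_apply_eq_comp]

theorem opTensor_tmul (S : H →L[ℂ] H) (T : K →L[ℂ] K) (h : H) (k : K) :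
    opTensor S T (toHilbertTensor H K (h ⊗ₜ k)) = toHilbertTensor H K (S h ⊗ₜ T k) := by
  rw [opTensor_coe, TensorProduct.mapL_tmul]

theorem inner_toHilbertTensor_tmul (h h' : H) (k k' : K) :
    ⟪toHilbertTensor H K (h ⊗ₜ k), toHilbertTensor H K (h' ⊗ₜ k')⟫_ℂ = ⟪h, h'⟫_ℂ * ⟪k, k'⟫_ℂ := by
  rw [LinearIsometry.inner_map_map, TensorProduct.inner_tmul]

theorem ext_inner_tmul {X Y : HilbertTensor H K →L[ℂ] HilbertTensor H K}
    (hXY : ∀ h k h' k', ⟪toHilbertTensor H K (h' ⊗ₜ k'), X (toHilbertTensor H K (h ⊗ₜ k))⟫_ℂ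
      = ⟪toHilbertTensor H K (h' ⊗ₜ k'), Y (toHilbertTensor H K (h ⊗ₜ k))⟫_ℂ) : X = Y := by
  refine ext_coe fun x => ?_
  refine ext_inner_left ℂ fun v => ?_
  refine denseRange_toHilbertTensor.induction_on
    (p := fun v => ⟪v, X (toHilbertTensor H K x)⟫_ℂ = ⟪v, Y (toHilbertTensor H K x)⟫_ℂ) v
    (isClosed_eq (by fun_prop) (by fun_prop)) fun y => ?_
  induction x with
  | zero => simp
  | add x x' hx hx' => simp only [map_add, inner_add_right, hx, hx']
  | tmul h k =>
    induction y with
    | zero => simp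
    | add y y' hy hy' => simp only [map_add, inner_add_left, hy, hy']
    | tmul h' k' => exact hXY h k h' k'

theorem star_opTensor [CompleteSpace H] [CompleteSpace K] (S : H →L[ℂ] H) (T : K →L[ℂ] K) :
    star (opTensor S T) = opTensor (star S) (star T) := by
  refine ext_inner_tmul fun h k h' k' => ?_
  rw [ContinuousLinearMap.star_eq_adjoint, ContinuousLinearMap.adjoint_inner_right, opTensor_tmul,
    opTensor_tmul, inner_toHilbertTensor_tmul, inner_toHilbertTensor_tmul,
    ContinuousLinearMap.star_eq_adjoint, ContinuousLinearMap.adjoint_inner_right,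
    ContinuousLinearMap.star_eq_adjoint, ContinuousLinearMap.adjoint_inner_right]

variable (H) in
/-- The operator `h ↦ h ⊗ k`. -/
def tmulRight (k : K) : H →L[ℂ] HilbertTensor H K :=
  (toHilbertTensor H K).toContinuousLinearMap ∘L (TensorProduct.mkL ℂ H K).flip k

theorem tmulRight_apply (h : H) (k : K) :
    tmulRight H k h = toHilbertTensor H K (h ⊗ₜ k) := rfl

theorem norm_tmulRight_le (k : K) : ‖tmulRight H k‖ ≤ ‖k‖ := by
  refine ContinuousLinearMap.opNorm_le_bound _ (norm_nonneg _) fun h => ?_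
  rw [tmulRight_apply, LinearIsometry.norm_map, TensorProduct.norm_tmul, mul_comm]

variable [CompleteSpace H]

/-- Slicing an operator on the tensor product by the vector functional of `k` and `k'`. -/
def vecSlice (k k' : K) (X : HilbertTensor H K →L[ℂ] HilbertTensor H K) : H →L[ℂ] H :=
  (tmulRight H k').adjoint ∘L X ∘L tmulRight H k

theorem inner_vecSlice (k k' : K) (X : HilbertTensor H K →L[ℂ] HilbertTensor H K) (h h' : H) :
    ⟪h', vecSlice k k' X h⟫_ℂ
      = ⟪toHilbertTensor H K (h' ⊗ₜ k'), X (toHilbertTensor H K (h ⊗ₜ k))⟫_ℂ := by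
  simp only [vecSlice, ContinuousLinearMap.comp_apply, ContinuousLinearMap.adjoint_inner_right,
    tmulRight_apply]

theorem norm_vecSlice_le (k k' : K) (X : HilbertTensor H K →L[ℂ] HilbertTensor H K) :
    ‖vecSlice k k' X‖ ≤ ‖k'‖ * (‖X‖ * ‖k‖) := by
  refine (ContinuousLinearMap.opNorm_comp_le _ _).trans ?_
  rw [LinearIsometryEquiv.norm_map]
  refine mul_le_mul (norm_tmulRight_le k') ((ContinuousLinearMap.opNorm_comp_le _ _).trans ?_)
    (norm_nonneg _) (norm_nonneg _)
  gcongr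
  exact norm_tmulRight_le k

end HilbertTensor

/-! ### Norms of the maps `X ↦ ∑ U⋆ X U`. -/

section ConjSum

open scoped InnerProductSpace

variable {E : Type*} [NormedAddCommGroup E] [InnerProductSpace ℂ E] [CompleteSpace E]

theorem sum_norm_sq_le {ι : Type*} [Fintype ι] (U : ι → E →L[ℂ] E) (ξ : E) :
    ∑ i, ‖U i ξ‖ ^ 2 ≤ ‖∑ i, star (U i) * U i‖ * ‖ξ‖ ^ 2 := by
  have h1 : ((∑ i, ‖U i ξ‖ ^ 2 : ℝ) : ℂ) = ⟪ξ, (∑ i, star (U i) * U i) ξ⟫_ℂ := by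
    simp only [sum_apply, inner_sum, mul_apply_eq_comp,
      ContinuousLinearMap.star_eq_adjoint, ContinuousLinearMap.adjoint_inner_right,
      inner_self_eq_norm_sq_to_K]
    push_cast
    rfl
  have h2 : ∑ i, ‖U i ξ‖ ^ 2 = ‖((∑ i, ‖U i ξ‖ ^ 2 : ℝ) : ℂ)‖ := by
    rw [Complex.norm_real, Real.norm_of_nonneg (by positivity)]
  rw [h2, h1]
  refine (norm_inner_le_norm _ _).trans ?_
  have := (∑ i, star (U i) * U i).le_opNorm ξ
  nlinarith [norm_nonneg ξ]

/-- The norm of the completely positive map `X ↦ ∑ U⋆ X U`. -/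
theorem norm_sum_star_mul_mul_le {ι : Type*} [Fintype ι] (U : ι → E →L[ℂ] E) (X : E →L[ℂ] E) :
    ‖∑ i, star (U i) * X * U i‖ ≤ ‖X‖ * ‖∑ i, star (U i) * U i‖ := by
  set G := ‖∑ i, star (U i) * U i‖ with hG
  have hG0 : 0 ≤ G := norm_nonneg _
  have key : ∀ ξ η : E, ‖⟪η, (∑ i, star (U i) * X * U i) ξ⟫_ℂ‖ ≤ ‖X‖ * G * (‖ξ‖ * ‖η‖) := by
    intro ξ η
    have h1 : ⟪η, (∑ i, star (U i) * X * U i) ξ⟫_ℂ = ∑ i, ⟪U i η, X (U i ξ)⟫_ℂ := by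
      simp only [sum_apply, inner_sum, mul_apply_eq_comp,
        ContinuousLinearMap.star_eq_adjoint, ContinuousLinearMap.adjoint_inner_right]
    rw [h1]
    have h2 : ∀ i, ‖⟪U i η, X (U i ξ)⟫_ℂ‖ ≤ ‖X‖ * (‖U i η‖ * ‖U i ξ‖) := by
      intro i
      refine (norm_inner_le_norm _ _).trans ?_
      have := X.le_opNorm (U i ξ)
      nlinarith [norm_nonneg (U i η)]
    -- Cauchy–Schwarz over the index `i`.
    have h3 : (∑ i, ‖U i η‖ * ‖U i ξ‖) ^ 2 ≤ (G * (‖ξ‖ * ‖η‖)) ^ 2 := by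
      refine (Finset.sum_mul_sq_le_sq_mul_sq _ _ _).trans ?_
      have := mul_le_mul (sum_norm_sq_le U η) (sum_norm_sq_le U ξ)
        (by positivity) (by positivity)
      refine this.trans (le_of_eq ?_)
      rw [← hG]; ring
    have h4 : ∑ i, ‖U i η‖ * ‖U i ξ‖ ≤ G * (‖ξ‖ * ‖η‖) :=
      (abs_le_of_sq_le_sq' h3 (by positivity)).2
    calc ‖∑ i, ⟪U i η, X (U i ξ)⟫_ℂ‖ ≤ ∑ i, ‖X‖ * (‖U i η‖ * ‖U i ξ‖) :=
          (norm_sum_le _ _).trans (Finset.sum_le_sum fun i _ => h2 i)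
      _ = ‖X‖ * ∑ i, ‖U i η‖ * ‖U i ξ‖ := by rw [Finset.mul_sum]
      _ ≤ ‖X‖ * (G * (‖ξ‖ * ‖η‖)) := by gcongr
      _ = _ := by ring
  refine ContinuousLinearMap.opNorm_le_bound _ (by positivity) fun ξ => ?_
  set ζ := (∑ i, star (U i) * X * U i) ξ with hζ
  have h := key ξ ζ
  rw [← hζ, inner_self_eq_norm_sq_to_K] at h
  by_cases h0 : ‖ζ‖ = 0
  · rw [h0]; positivity
  · have hpos : 0 < ‖ζ‖ := lt_of_le_of_ne (norm_nonneg _) (Ne.symm h0)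
    have h' : ‖ζ‖ ^ 2 ≤ ‖X‖ * G * (‖ξ‖ * ‖ζ‖) := by
      simpa using h
    nlinarith

end ConjSum

/-! ### Density of the algebraic tensors. -/

section MinTensor

variable {A B H K : Type*}
  [NormedAddCommGroup H] [InnerProductSpace ℂ H] [CompleteSpace H]
  [NormedAddCommGroup K] [InnerProductSpace ℂ K] [CompleteSpace K]
  [NonUnitalRing A] [Module ℂ A] [Star A] [NonUnitalRing B] [Module ℂ B] [Star B]
  (π : A →⋆ₙₐ[ℂ] (H →L[ℂ] H)) (ρ : B →⋆ₙₐ[ℂ] (K →L[ℂ] K))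

@[simp]
theorem tensorRep_tmul (a : A) (b : B) : tensorRep π ρ (a ⊗ₜ b) = opTensor (π a) (ρ b) := rfl

@[simp]
theorem coe_tensorIncl (z : A ⊗[ℂ] B) :
    (tensorIncl π ρ z : HilbertTensor H K →L[ℂ] HilbertTensor H K) = tensorRep π ρ z := rfl

theorem tensorRep_mul_mem_range (x y : A ⊗[ℂ] B) :
    tensorRep π ρ x * tensorRep π ρ y ∈ (tensorRep π ρ).range := by
  induction x with
  | zero => simp
  | add x x' hx hx' => rw [map_add, add_mul]; exact add_mem hx hx'
  | tmul a b =>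
    induction y with
    | zero => simp
    | add y y' hy hy' => rw [map_add, mul_add]; exact add_mem hy hy'
    | tmul a' b' =>
      refine ⟨(a * a') ⊗ₜ (b * b'), ?_⟩
      rw [tensorRep_tmul, tensorRep_tmul, tensorRep_tmul, opTensor_mul, map_mul, map_mul]

theorem star_tensorRep_mem_range (x : A ⊗[ℂ] B) :
    star (tensorRep π ρ x) ∈ (tensorRep π ρ).range := by
  induction x with
  | zero => simp
  | add x x' hx hx' => rw [map_add, star_add]; exact add_mem hx hx'
  | tmul a b =>
    refine ⟨star a ⊗ₜ star b, ?_⟩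
    rw [tensorRep_tmul, tensorRep_tmul, star_opTensor, map_star, map_star]

theorem coe_minTensor :
    (minTensor π ρ : Set (HilbertTensor H K →L[ℂ] HilbertTensor H K))
      = closure (Set.range (tensorRep π ρ)) := by
  refine subset_antisymm ?_ ?_
  · refine closure_mono fun x hx => ?_
    change x ∈ (tensorRep π ρ).range
    induction hx using NonUnitalStarAlgebra.adjoin_induction with
    | mem x hx =>
      obtain ⟨a, b, rfl⟩ := hx
      exact ⟨a ⊗ₜ b, rfl⟩
    | zero => exact zero_mem _
    | add x y _ _ hx hy => exact add_mem hx hy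
    | mul x y _ _ hx hy =>
      obtain ⟨x, rfl⟩ := hx
      obtain ⟨y, rfl⟩ := hy
      exact tensorRep_mul_mem_range π ρ x y
    | smul r x _ hx => exact Submodule.smul_mem _ r hx
    | star x _ hx =>
      obtain ⟨x, rfl⟩ := hx
      exact star_tensorRep_mem_range π ρ x
  · refine closure_minimal ?_ (NonUnitalStarSubalgebra.isClosed_topologicalClosure _)
    rintro _ ⟨x, rfl⟩
    exact tensorRep_mem π ρ x

theorem isClosed_minTensor :
    IsClosed (minTensor π ρ : Set (HilbertTensor H K →L[ℂ] HilbertTensor H K)) :=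
  NonUnitalStarSubalgebra.isClosed_topologicalClosure _

theorem denseRange_tensorIncl : DenseRange (tensorIncl π ρ) := by
  intro x
  have hx : (x : HilbertTensor H K →L[ℂ] HilbertTensor H K) ∈ closure (Set.range (tensorRep π ρ)) := by
    rw [← coe_minTensor]; exact x.2
  refine Metric.mem_closure_iff.2 fun ε hε => ?_
  obtain ⟨_, ⟨z, rfl⟩, hz⟩ := Metric.mem_closure_iff.1 hx ε hε
  exact ⟨tensorIncl π ρ z, ⟨z, rfl⟩, hz⟩

end MinTensor

section OpTensorRep

variable {B H K : Type*} [NonUnitalCStarAlgebra B]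
  [NormedAddCommGroup H] [InnerProductSpace ℂ H]
  [NormedAddCommGroup K] [InnerProductSpace ℂ K] [CompleteSpace K]
  (ρ : B →⋆ₙₐ[ℂ] (K →L[ℂ] K))

/-- A representation as a continuous linear map. -/
def repL : B →L[ℂ] (K →L[ℂ] K) :=
  (ρ : B →ₗ[ℂ] (K →L[ℂ] K)).mkContinuous 1 fun b => by
    simpa using NonUnitalStarAlgHom.norm_apply_le ρ b

/-- The continuous linear map `b ↦ S ⊗ ρ b`. -/
def opTensorRep (S : H →L[ℂ] H) : B →L[ℂ] (HilbertTensor H K →L[ℂ] HilbertTensor H K) :=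
  (opTensorₗ H K S).mkContinuous ‖S‖ (norm_opTensor_le S) ∘L repL ρ

theorem opTensorRep_apply (S : H →L[ℂ] H) (b : B) :
    opTensorRep ρ S b = opTensor S (ρ b) := rfl

end OpTensorRep

/-! ### Left and right slice maps. -/

section Slice

open scoped InnerProductSpace

variable {A B H K : Type*} [NonUnitalCStarAlgebra A] [NonUnitalCStarAlgebra B]
  [NormedAddCommGroup H] [InnerProductSpace ℂ H] [CompleteSpace H]
  [NormedAddCommGroup K] [InnerProductSpace ℂ K] [CompleteSpace K]
  (π : A →⋆ₙₐ[ℂ] (H →L[ℂ] H)) (ρ : B →⋆ₙₐ[ℂ] (K →L[ℂ] K))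

/-- The slice map `φ ⊗ id` on the algebraic tensor product. -/
abbrev algSlice (B : Type*) [NonUnitalCStarAlgebra B] (φ : A →L[ℂ] ℂ) : A ⊗[ℂ] B →ₗ[ℂ] B :=
  (TensorProduct.lid ℂ B).toLinearMap ∘ₗ LinearMap.rTensor B (φ : A →ₗ[ℂ] ℂ)

theorem algSlice_tmul (φ : A →L[ℂ] ℂ) (a : A) (b : B) : algSlice B φ (a ⊗ₜ b) = φ a • b := by
  simp [algSlice]

/-- The slice map `id ⊗ ψ` on the algebraic tensor product. -/
abbrev algRightSlice (A : Type*) [NonUnitalCStarAlgebra A] (ψ : B →L[ℂ] ℂ) : A ⊗[ℂ] B →ₗ[ℂ] A :=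
  (TensorProduct.rid ℂ A).toLinearMap ∘ₗ LinearMap.lTensor A (ψ : B →ₗ[ℂ] ℂ)

theorem algRightSlice_tmul (ψ : B →L[ℂ] ℂ) (a : A) (b : B) :
    algRightSlice A ψ (a ⊗ₜ b) = ψ b • a := by
  simp [algRightSlice]

theorem apply_algRightSlice (φ : A →L[ℂ] ℂ) (ψ : B →L[ℂ] ℂ) (z : A ⊗[ℂ] B) :
    φ (algRightSlice A ψ z) = ψ (algSlice B φ z) := by
  induction z with
  | zero => simp
  | add x y hx hy => simp only [map_add, hx, hy]
  | tmul a b =>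
    rw [algRightSlice_tmul, algSlice_tmul, map_smul, map_smul, smul_eq_mul, smul_eq_mul, mul_comm]

/-- The functional `T ↦ ⟪v', T v⟫`. -/
def vecFunctional {E : Type*} [NormedAddCommGroup E] [InnerProductSpace ℂ E] (v v' : E) :
    (E →L[ℂ] E) →L[ℂ] ℂ :=
  innerSL ℂ v' ∘L ContinuousLinearMap.apply ℂ E v

theorem vecFunctional_apply {E : Type*} [NormedAddCommGroup E] [InnerProductSpace ℂ E] (v v' : E)
    (T : E →L[ℂ] E) : vecFunctional v v' T = ⟪v', T v⟫_ℂ := rfl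

theorem vecSlice_tensorRep (k k' : K) (z : A ⊗[ℂ] B) :
    vecSlice k k' (tensorRep π ρ z)
      = π (algRightSlice A (vecFunctional k k' ∘L repL ρ) z) := by
  refine ContinuousLinearMap.ext fun h => ext_inner_left ℂ fun h' => ?_
  rw [inner_vecSlice]
  induction z with
  | zero => simp
  | add x y hx hy =>
    simp only [map_add, add_apply, inner_add_right, hx, hy]
  | tmul a b =>
    rw [algRightSlice_tmul, tensorRep_tmul, opTensor_tmul, inner_toHilbertTensor_tmul, map_smul,
      smul_apply, inner_smul_right, mul_comm]
    rfl

variable {π ρ}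

theorem norm_le_of_inner_le {E : Type*} [NormedAddCommGroup E] [InnerProductSpace ℂ E]
    {T : E →L[ℂ] E} {r : ℝ} (hr : 0 ≤ r) (h : ∀ ξ η, ‖⟪η, T ξ⟫_ℂ‖ ≤ r * (‖η‖ * ‖ξ‖)) :
    ‖T‖ ≤ r := by
  refine ContinuousLinearMap.opNorm_le_bound _ hr fun ξ => ?_
  have h1 := h ξ (T ξ)
  rw [inner_self_eq_norm_sq_to_K] at h1
  have h2 : ‖T ξ‖ ^ 2 ≤ r * (‖T ξ‖ * ‖ξ‖) := by simpa using h1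
  by_cases h0 : ‖T ξ‖ = 0
  · rw [h0]; positivity
  · have hpos : 0 < ‖T ξ‖ := lt_of_le_of_ne (norm_nonneg _) (Ne.symm h0)
    nlinarith

/-- A matrix coefficient of the slice by `φ` is `φ` applied to a right slice by a vector functional.
The latter is a compression of the operator, so its norm is controlled by that of `z`. -/
theorem norm_algSlice_le (hπ : Function.Injective π) (hρ : Function.Injective ρ) (φ : A →L[ℂ] ℂ)
    (z : A ⊗[ℂ] B) : ‖algSlice B φ z‖ ≤ ‖φ‖ * ‖tensorIncl π ρ z‖ := by
  rw [← NonUnitalStarAlgHom.norm_map ρ hρ]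
  refine norm_le_of_inner_le (by positivity) fun k k' => ?_
  have h1 : ⟪k', ρ (algSlice B φ z) k⟫_ℂ
      = φ (algRightSlice A (vecFunctional k k' ∘L repL ρ) z) := by
    rw [apply_algRightSlice]; rfl
  rw [h1]
  refine (φ.le_opNorm _).trans ?_
  rw [← NonUnitalStarAlgHom.norm_map π hπ, ← vecSlice_tensorRep, mul_assoc]
  gcongr
  refine (norm_vecSlice_le k k' _).trans (le_of_eq ?_)
  change ‖k'‖ * (‖tensorRep π ρ z‖ * ‖k‖) = ‖tensorRep π ρ z‖ * (‖k'‖ * ‖k‖)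
  ring

theorem slice_tensorIncl (hπ : Function.Injective π) (hρ : Function.Injective ρ) (φ : A →L[ℂ] ℂ)
    (z : A ⊗[ℂ] B) : slice π ρ φ (tensorIncl π ρ z) = algSlice B φ z :=
  LinearMap.extendOfNorm_eq (denseRange_tensorIncl π ρ) ⟨‖φ‖, norm_algSlice_le hπ hρ φ⟩ z

theorem norm_slice_le (hπ : Function.Injective π) (hρ : Function.Injective ρ) (φ : A →L[ℂ] ℂ)
    (x : minTensor π ρ) : ‖slice π ρ φ x‖ ≤ ‖φ‖ * ‖x‖ :=
  LinearMap.norm_extendOfNorm_apply_le (denseRange_tensorIncl π ρ) _ (norm_algSlice_le hπ hρ φ) x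

variable (π ρ) in
/-- The slice map `id ⊗ ψ : A ⊗ B → A`. -/
def rightSlice (ψ : B →L[ℂ] ℂ) : minTensor π ρ →L[ℂ] A :=
  (algRightSlice A ψ).extendOfNorm (tensorIncl π ρ)

theorem norm_algRightSlice_le (hπ : Function.Injective π) (hρ : Function.Injective ρ)
    (ψ : B →L[ℂ] ℂ) (z : A ⊗[ℂ] B) : ‖algRightSlice A ψ z‖ ≤ ‖ψ‖ * ‖tensorIncl π ρ z‖ := by
  obtain ⟨φ, hφ, hφz⟩ := exists_dual_vector'' ℂ (algRightSlice A ψ z)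
  have h1 : ‖algRightSlice A ψ z‖ = ‖ψ (algSlice B φ z)‖ := by
    rw [← apply_algRightSlice, hφz]; simp
  rw [h1]
  refine (ψ.le_opNorm _).trans ?_
  gcongr
  refine (norm_algSlice_le hπ hρ φ z).trans ?_
  exact mul_le_of_le_one_left (norm_nonneg _) hφ

theorem rightSlice_tensorIncl (hπ : Function.Injective π) (hρ : Function.Injective ρ)
    (ψ : B →L[ℂ] ℂ) (z : A ⊗[ℂ] B) :
    rightSlice π ρ ψ (tensorIncl π ρ z) = algRightSlice A ψ z :=
  LinearMap.extendOfNorm_eq (denseRange_tensorIncl π ρ) ⟨‖ψ‖, norm_algRightSlice_le hπ hρ ψ⟩ z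

theorem norm_rightSlice_le (hπ : Function.Injective π) (hρ : Function.Injective ρ)
    (ψ : B →L[ℂ] ℂ) (x : minTensor π ρ) : ‖rightSlice π ρ ψ x‖ ≤ ‖ψ‖ * ‖x‖ :=
  LinearMap.norm_extendOfNorm_apply_le (denseRange_tensorIncl π ρ) _
    (norm_algRightSlice_le hπ hρ ψ) x

/-- Fubini for slices; it trades the functional `φ` on `A` for the functional `ψ` on `B`. -/
theorem apply_rightSlice (hπ : Function.Injective π) (hρ : Function.Injective ρ)
    (φ : A →L[ℂ] ℂ) (ψ : B →L[ℂ] ℂ) (x : minTensor π ρ) :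
    φ (rightSlice π ρ ψ x) = ψ (slice π ρ φ x) := by
  refine (denseRange_tensorIncl π ρ).induction_on
    (p := fun x => φ (rightSlice π ρ ψ x) = ψ (slice π ρ φ x)) x
    (isClosed_eq (by fun_prop) (by fun_prop)) fun z => ?_
  rw [slice_tensorIncl hπ hρ, rightSlice_tensorIncl hπ hρ, apply_algRightSlice]

theorem opTensor_mul_tensorRep (a : A) (z : A ⊗[ℂ] B) :
    opTensor (π a) 1 * tensorRep π ρ z
      = tensorRep π ρ (LinearMap.rTensor B (LinearMap.mulLeft ℂ a) z) := by
  induction z with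
  | zero => simp
  | add x y hx hy => simp only [map_add, mul_add, hx, hy]
  | tmul a' b =>
    rw [LinearMap.rTensor_tmul, tensorRep_tmul, tensorRep_tmul, opTensor_mul, one_mul,
      LinearMap.mulLeft_apply, map_mul]

theorem algRightSlice_mulLeft (ψ : B →L[ℂ] ℂ) (a : A) (z : A ⊗[ℂ] B) :
    algRightSlice A ψ (LinearMap.rTensor B (LinearMap.mulLeft ℂ a) z)
      = a * algRightSlice A ψ z := by
  induction z with
  | zero => simp
  | add x y hx hy => simp only [map_add, mul_add, hx, hy]
  | tmul a' b =>
    rw [LinearMap.rTensor_tmul, algRightSlice_tmul, algRightSlice_tmul, LinearMap.mulLeft_apply,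
      mul_smul_comm]

theorem rightSlice_mul_left (hπ : Function.Injective π) (hρ : Function.Injective ρ)
    (ψ : B →L[ℂ] ℂ) (a : A) (x y : minTensor π ρ)
    (hy : (y : HilbertTensor H K →L[ℂ] HilbertTensor H K) =
      opTensor (π a) 1 * (x : HilbertTensor H K →L[ℂ] HilbertTensor H K)) :
    rightSlice π ρ ψ y = a * rightSlice π ρ ψ x := by
  have hmem : ∀ x : minTensor π ρ,
      opTensor (π a) 1 * (x : HilbertTensor H K →L[ℂ] HilbertTensor H K) ∈ minTensor π ρ := by
    intro x
    refine (denseRange_tensorIncl π ρ).induction_on (p := fun x : minTensor π ρ =>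
      opTensor (π a) 1 * (x : HilbertTensor H K →L[ℂ] HilbertTensor H K) ∈ minTensor π ρ) x ?_ ?_
    · exact (NonUnitalStarSubalgebra.isClosed_topologicalClosure _).preimage
        (continuous_const.mul continuous_subtype_val)
    · intro z
      rw [coe_tensorIncl, opTensor_mul_tensorRep]
      exact tensorRep_mem π ρ _
  have hyx : y = ⟨_, hmem x⟩ := Subtype.ext hy
  rw [hyx]
  refine (denseRange_tensorIncl π ρ).induction_on
    (p := fun x => rightSlice π ρ ψ ⟨_, hmem x⟩ = a * rightSlice π ρ ψ x) x ?_ ?_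
  · refine isClosed_eq ((rightSlice π ρ ψ).continuous.comp ?_) (by fun_prop)
    exact Continuous.subtype_mk (continuous_const.mul continuous_subtype_val) _
  · intro z
    have : (⟨_, hmem (tensorIncl π ρ z)⟩ : minTensor π ρ)
        = tensorIncl π ρ (LinearMap.rTensor B (LinearMap.mulLeft ℂ a) z) :=
      Subtype.ext (opTensor_mul_tensorRep a z)
    rw [this, rightSlice_tensorIncl hπ hρ, rightSlice_tensorIncl hπ hρ, algRightSlice_mulLeft]

/-- Matrix coefficients of an element of `A ⊗ B` in terms of its slices. -/
theorem inner_eq_inner_slice (hπ : Function.Injective π) (hρ : Function.Injective ρ)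
    (x : minTensor π ρ) (h h' : H) (k k' : K) :
    ⟪toHilbertTensor H K (h' ⊗ₜ k'),
        (x : HilbertTensor H K →L[ℂ] HilbertTensor H K) (toHilbertTensor H K (h ⊗ₜ k))⟫_ℂ
      = ⟪k', ρ (slice π ρ (vecFunctional h h' ∘L repL π) x) k⟫_ℂ := by
  have key : ∀ x : minTensor π ρ,
      vecFunctional (toHilbertTensor H K (h ⊗ₜ k)) (toHilbertTensor H K (h' ⊗ₜ k')) x
        = vecFunctional k k' (repL ρ (slice π ρ (vecFunctional h h' ∘L repL π) x)) := by
    intro x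
    refine (denseRange_tensorIncl π ρ).induction_on (p := fun x : minTensor π ρ =>
      vecFunctional (toHilbertTensor H K (h ⊗ₜ k)) (toHilbertTensor H K (h' ⊗ₜ k')) x
        = vecFunctional k k' (repL ρ (slice π ρ (vecFunctional h h' ∘L repL π) x))) x
      (isClosed_eq (by fun_prop) (by fun_prop)) fun z => ?_
    rw [slice_tensorIncl hπ hρ, coe_tensorIncl]
    induction z with
    | zero => simp
    | add x y hx hy => simp only [map_add, hx, hy]
    | tmul a b =>
      rw [algSlice_tmul, tensorRep_tmul, vecFunctional_apply, opTensor_tmul,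
        inner_toHilbertTensor_tmul, map_smul, map_smul]
      rfl
  exact key x

/-- Slices separate the points of `A ⊗ B`. -/
theorem ext_slice (hπ : Function.Injective π) (hρ : Function.Injective ρ) {x y : minTensor π ρ}
    (h : ∀ φ, slice π ρ φ x = slice π ρ φ y) : x = y :=
  Subtype.ext <| ext_inner_tmul fun _ _ _ _ => by
    rw [inner_eq_inner_slice hπ hρ, inner_eq_inner_slice hπ hρ, h]

end Slice

theorem le_of_forall_pos_le {p q : ℝ → ℝ} (hp : Continuous p) (hq : Continuous q)
    (h : ∀ ε > 0, p ε ≤ q ε) : p 0 ≤ q 0 :=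
  le_of_tendsto_of_tendsto (b := nhdsWithin 0 (Set.Ioi 0))
    ((hp.tendsto 0).mono_left nhdsWithin_le_nhds) ((hq.tendsto 0).mono_left nhdsWithin_le_nhds)
    (Filter.eventually_of_mem self_mem_nhdsWithin fun ε hε => h ε hε)

/-- Every element of `A ⊗ B` is a sum of elementary tensors with self-adjoint left factors. -/
theorem exists_sum_selfAdjoint_tmul {A B : Type*} [NonUnitalCStarAlgebra A]
    [NonUnitalCStarAlgebra B] (z : A ⊗[ℂ] B) :
    ∃ (ι : Type) (_ : Fintype ι) (x : ι → A) (b : ι → B),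
      (∀ i, IsSelfAdjoint (x i)) ∧ z = ∑ i, x i ⊗ₜ b i := by
  induction z with
  | zero => exact ⟨Empty, inferInstance, Empty.elim, Empty.elim, by simp, by simp⟩
  | add z z' hz hz' =>
    obtain ⟨ι, _, x, b, hx, rfl⟩ := hz
    obtain ⟨κ, _, x', b', hx', rfl⟩ := hz'
    refine ⟨ι ⊕ κ, inferInstance, Sum.elim x x', Sum.elim b b', ?_, by simp⟩
    rintro (i | i)
    exacts [hx i, hx' i]
  | tmul a b =>
    refine ⟨Bool, inferInstance, fun i => if i then (realPart a : A) else (imaginaryPart a : A),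
      fun i => if i then b else Complex.I • b, ?_, ?_⟩
    · rintro (_ | _)
      exacts [(imaginaryPart a).2, (realPart a).2]
    · simp only [Fintype.sum_bool, if_true, Bool.false_eq_true, if_false]
      rw [← TensorProduct.smul_tmul, ← TensorProduct.add_tmul, realPart_add_I_smul_imaginaryPart]

theorem norm_opTensor_rep_one_le {A H K : Type*} [NonUnitalCStarAlgebra A]
    [NormedAddCommGroup H] [InnerProductSpace ℂ H] [CompleteSpace H]
    [NormedAddCommGroup K] [InnerProductSpace ℂ K] {π : A →⋆ₙₐ[ℂ] (H →L[ℂ] H)} (a : A) :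
    ‖opTensor (π a) (1 : K →L[ℂ] K)‖ ≤ ‖a‖ := by
  refine (norm_opTensor_le _ _).trans ?_
  refine (mul_le_mul (NonUnitalStarAlgHom.norm_apply_le π a) ContinuousLinearMap.norm_id_le
    (norm_nonneg _) (norm_nonneg _)).trans ?_
  rw [mul_one]

/-! ### Slices of an `A`-invariant algebra. -/

section KeyClaim

variable {A B H K : Type*} [NonUnitalCStarAlgebra A] [NonUnitalCStarAlgebra B]
  [NormedAddCommGroup H] [InnerProductSpace ℂ H] [CompleteSpace H]
  [NormedAddCommGroup K] [InnerProductSpace ℂ K] [CompleteSpace K]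

variable {π : A →⋆ₙₐ[ℂ] (H →L[ℂ] H)} {ρ : B →⋆ₙₐ[ℂ] (K →L[ℂ] K)}

theorem norm_opTensor_rep_le (a : A) (b : B) : ‖opTensor (π a) (ρ b)‖ ≤ ‖a‖ * ‖b‖ :=
  (norm_opTensor_le _ _).trans (mul_le_mul (NonUnitalStarAlgHom.norm_apply_le π a)
    (NonUnitalStarAlgHom.norm_apply_le ρ b) (norm_nonneg _) (norm_nonneg _))

theorem norm_conjSum_le (hπ : Function.Injective π) {ι : Type*} [Fintype ι] (u : ι → A) (y : A) :
    ‖∑ i, star (u i) * y * u i‖ ≤ ‖y‖ * ‖∑ i, star (u i) * u i‖ := by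
  have h := norm_sum_star_mul_mul_le (fun i => π (u i)) (π y)
  simp only [← map_star, ← map_mul, ← map_sum] at h
  rwa [NonUnitalStarAlgHom.norm_map π hπ, NonUnitalStarAlgHom.norm_map π hπ,
    NonUnitalStarAlgHom.norm_map π hπ] at h

theorem norm_conjSum_opTensor_le {ι : Type*} [Fintype ι] (u : ι → A)
    (X : HilbertTensor H K →L[ℂ] HilbertTensor H K) :
    ‖∑ i, star (opTensor (π (u i)) (1 : K →L[ℂ] K)) * X * opTensor (π (u i)) 1‖
      ≤ ‖X‖ * ‖∑ i, star (u i) * u i‖ := by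
  refine (norm_sum_star_mul_mul_le _ _).trans ?_
  gcongr
  have : ∑ i, star (opTensor (π (u i)) (1 : K →L[ℂ] K)) * opTensor (π (u i)) 1
      = opTensor (π (∑ i, star (u i) * u i)) 1 := by
    rw [← opTensorLeft_apply, map_sum, map_sum]
    refine Finset.sum_congr rfl fun i _ => ?_
    rw [star_opTensor, opTensor_mul, opTensorLeft_apply, star_one, one_mul, map_mul, map_star]
  rw [this]
  exact norm_opTensor_rep_one_le _

theorem conjSum_opTensor {ι : Type*} [Fintype ι] (u : ι → A) (x : A) (b : B) :
    ∑ i, star (opTensor (π (u i)) (1 : K →L[ℂ] K)) * opTensor (π x) (ρ b) * opTensor (π (u i)) 1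
      = opTensor (π (∑ i, star (u i) * x * u i)) (ρ b) := by
  rw [← opTensorLeft_apply (π (∑ i, star (u i) * x * u i)), map_sum, map_sum]
  refine Finset.sum_congr rfl fun i _ => ?_
  rw [star_opTensor, opTensor_mul, opTensor_mul, opTensorLeft_apply, star_one, one_mul, mul_one,
    map_mul, map_mul, map_star]

/-- The functional `b ↦ f (a ⊗ b)`. -/
def partialFunctional (π : A →⋆ₙₐ[ℂ] (H →L[ℂ] H)) (ρ : B →⋆ₙₐ[ℂ] (K →L[ℂ] K))
    (f : (HilbertTensor H K →L[ℂ] HilbertTensor H K) →L[ℂ] ℂ) (a : A) : B →L[ℂ] ℂ :=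
  f ∘L opTensorRep ρ (π a)

theorem partialFunctional_apply (f : (HilbertTensor H K →L[ℂ] HilbertTensor H K) →L[ℂ] ℂ) (a : A)
    (b : B) : partialFunctional π ρ f a b = f (opTensor (π a) (ρ b)) := rfl

/-- The averaging argument with explicit errors: `δ` measures the approximation of `c` by an
algebraic tensor, `ε` the precision of the averaging. The three terms on the right bound, in turn,
`S(g)` against `S` of the approximant, that against `L a`, and `L a` itself. -/
theorem averaging_estimate (hA : IsSimple A) (hπ : Function.Injective π)
    (hρ : Function.Injective ρ) {C : NonUnitalStarSubalgebra ℂ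
      (HilbertTensor H K →L[ℂ] HilbertTensor H K)}
    (hAC : ∀ (a : A), ∀ c ∈ C, opTensor (π a) (1 : K →L[ℂ] K) * c ∈ C ∧
      c * opTensor (π a) (1 : K →L[ℂ] K) ∈ C)
    (f : (HilbertTensor H K →L[ℂ] HilbertTensor H K) →L[ℂ] ℂ) (hf : ∀ c ∈ C, f c = 0)
    (d : A) (c : minTensor π ρ) (hc : (c : HilbertTensor H K →L[ℂ] HilbertTensor H K) ∈ C)
    {y : A} (hy : y ≠ 0)
    (h : rightSlice π ρ (partialFunctional π ρ f (d * star d)) c = star y * y)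
    {ι : Type} [Fintype ι] (x : ι → A) (b : ι → B) (hx : ∀ i, IsSelfAdjoint (x i))
    {δ : ℝ} (hδ : ‖c - tensorIncl π ρ (∑ i, x i ⊗ₜ b i)‖ ≤ δ) {ε : ℝ} (hε : 0 < ε) :
    ‖star y * y‖ / 2 * (‖d * star d‖ - ε) ≤
      (‖partialFunctional π ρ f (d * star d)‖ * δ) * (‖d * star d‖ + ε)
      + (∑ i, ‖partialFunctional π ρ f (d * star d) (b i)‖) * ε
      + ‖f‖ * (ε * ∑ i, ‖b i‖ + δ * (‖d * star d‖ + ε)) * ‖d * star d‖ := by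
  classical
  let _ := CStarAlgebra.spectralOrder A
  have := CStarAlgebra.spectralOrderedRing A
  set a := d * star d with ha
  set ψ := partialFunctional π ρ f a with hψ
  set g := star y * y with hg
  have hg0 : g ≠ 0 := fun h0 => hy (CStarRing.star_mul_self_eq_zero_iff y |>.1 h0)
  have hgnn : 0 ≤ g := star_mul_self_nonneg y
  obtain ⟨κ, _, u, l, h1, h2, h3⟩ := exists_averaging hA hgnn hg0
    (Finset.univ.image x) (by simpa using hx) d hε
  rw [← ha] at h1 h3
  have h3' : ∀ j, ‖∑ i, star (u i) * x j * u i - l (x j) • a‖ ≤ ε :=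
    fun j => h3 (x j) (Finset.mem_image_of_mem _ (Finset.mem_univ j))
  set G := ∑ i, star (u i) * u i with hG
  have hGu : ‖G‖ ≤ ‖a‖ + ε := by
    have := norm_le_norm_add_norm_sub' G a
    linarith
  have hGl : ‖a‖ - ε ≤ ‖G‖ := by
    have := norm_le_norm_add_norm_sub' a G
    rw [norm_sub_rev] at this
    linarith
  have hδ0 : 0 ≤ δ := (norm_nonneg _).trans hδ
  -- the scalar by which the averaging map acts
  let L : ℂ := ∑ j, (l (x j) : ℂ) * ψ (b j)
  let T : (HilbertTensor H K →L[ℂ] HilbertTensor H K) →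
      (HilbertTensor H K →L[ℂ] HilbertTensor H K) := fun X =>
    ∑ i, star (opTensor (π (u i)) (1 : K →L[ℂ] K)) * X * opTensor (π (u i)) 1
  let z : A ⊗[ℂ] B := ∑ i, x i ⊗ₜ b i
  -- Averaging over `A` preserves `C`, and `f` vanishes there.
  have hTc : f (T c) = 0 := by
    refine hf _ (sum_mem fun i _ => (hAC _ _ ?_).2)
    have := (hAC (star (u i)) c hc).1
    rwa [map_star, ← star_one (R := K →L[ℂ] K), ← star_opTensor] at this
  have hTz : T (tensorRep π ρ z) = ∑ j, opTensor (π (∑ i, star (u i) * x j * u i)) (ρ (b j)) := by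
    simp only [T, z, map_sum, Finset.mul_sum, Finset.sum_mul]
    rw [Finset.sum_comm]
    refine Finset.sum_congr rfl fun j _ => ?_
    rw [← map_sum, ← conjSum_opTensor]
    rfl
  have hTsub : ‖T (tensorRep π ρ z) - T c‖ ≤ δ * (‖a‖ + ε) := by
    have e : T (tensorRep π ρ z) - T c = T (tensorRep π ρ z - c) := by
      simp only [T, ← Finset.sum_sub_distrib, ← sub_mul, ← mul_sub]
    rw [e]
    refine (norm_conjSum_opTensor_le u _).trans ?_
    rw [norm_sub_rev]
    exact mul_le_mul hδ hGu (norm_nonneg _) hδ0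
  have hL : L = f (∑ j, opTensor (π (l (x j) • a)) (ρ (b j))) := by
    rw [map_sum]
    refine Finset.sum_congr rfl fun j _ => ?_
    rw [hψ, partialFunctional_apply, ← opTensorLeft_apply, ← opTensorLeft_apply,
      ← Complex.coe_smul, map_smul, map_smul, map_smul, smul_eq_mul]
  have hLz : ‖∑ j, opTensor (π (l (x j) • a)) (ρ (b j)) - T (tensorRep π ρ z)‖
      ≤ ε * ∑ j, ‖b j‖ := by
    rw [hTz, ← Finset.sum_sub_distrib, Finset.mul_sum]
    refine (norm_sum_le _ _).trans (Finset.sum_le_sum fun j _ => ?_)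
    rw [← opTensorLeft_apply, ← opTensorLeft_apply, ← map_sub, ← map_sub, opTensorLeft_apply]
    refine (norm_opTensor_rep_le _ _).trans ?_
    rw [norm_sub_rev]
    exact mul_le_mul_of_nonneg_right (h3' j) (norm_nonneg _)
  have hLn : ‖L‖ ≤ ‖f‖ * (ε * ∑ j, ‖b j‖ + δ * (‖a‖ + ε)) := by
    have e : L = f (∑ j, opTensor (π (l (x j) • a)) (ρ (b j)) - T c) := by
      rw [map_sub, hTc, sub_zero, hL]
    rw [e]
    refine (f.le_opNorm _).trans ?_
    gcongr
    exact (norm_sub_le_norm_sub_add_norm_sub _ (T (tensorRep π ρ z)) _).trans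
      (add_le_add hLz hTsub)
  -- the same averages in `A`
  let S : A → A := fun v => ∑ i, star (u i) * v * u i
  have hz : algRightSlice A ψ z = ∑ j, ψ (b j) • x j := by
    simp only [z, map_sum, algRightSlice_tmul]
  have hSz : S (algRightSlice A ψ z) = ∑ j, ψ (b j) • S (x j) := by
    rw [hz]
    simp only [S, Finset.mul_sum, Finset.sum_mul, Finset.smul_sum, mul_smul_comm, smul_mul_assoc]
    rw [Finset.sum_comm]
  have hS1 : ‖S g - S (algRightSlice A ψ z)‖ ≤ (‖ψ‖ * δ) * (‖a‖ + ε) := by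
    have e : S g - S (algRightSlice A ψ z) = S (g - algRightSlice A ψ z) := by
      simp only [S, ← Finset.sum_sub_distrib, ← sub_mul, ← mul_sub]
    rw [e]
    refine (norm_conjSum_le hπ u _).trans ?_
    refine mul_le_mul ?_ hGu (norm_nonneg _) (by positivity)
    rw [← h, ← rightSlice_tensorIncl hπ hρ, ← map_sub]
    refine (norm_rightSlice_le hπ hρ ψ _).trans ?_
    gcongr
  have hS2 : ‖S (algRightSlice A ψ z) - L • a‖ ≤ (∑ j, ‖ψ (b j)‖) * ε := by
    have e : S (algRightSlice A ψ z) - L • a = ∑ j, ψ (b j) • (S (x j) - l (x j) • a) := by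
      simp only [hSz, L, Finset.sum_smul, ← Finset.sum_sub_distrib, smul_sub]
      refine Finset.sum_congr rfl fun j _ => ?_
      rw [mul_comm, mul_smul, Complex.coe_smul]
    rw [e, Finset.sum_mul]
    refine (norm_sum_le _ _).trans (Finset.sum_le_sum fun j _ => ?_)
    rw [norm_smul]
    exact mul_le_mul_of_nonneg_left (h3' j) (norm_nonneg _)
  have hSg : ‖g‖ / 2 * ‖G‖ ≤ ‖S g‖ := by
    have hnn : 0 ≤ (‖g‖ / 2) • G :=
      smul_nonneg (by positivity) (Finset.sum_nonneg fun i _ => star_mul_self_nonneg _)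
    have := CStarAlgebra.norm_le_norm_of_nonneg_of_le hnn h2
    rwa [norm_smul, Real.norm_of_nonneg (by positivity)] at this
  have hfin : ‖S g‖ ≤ ‖S g - S (algRightSlice A ψ z)‖ + ‖S (algRightSlice A ψ z) - L • a‖
      + ‖L‖ * ‖a‖ := by
    rw [← norm_smul]
    have e : S g = (S g - S (algRightSlice A ψ z)) + (S (algRightSlice A ψ z) - L • a) + L • a := by
      abel
    conv_lhs => rw [e]
    exact norm_add₃_le
  have hLa := mul_le_mul_of_nonneg_right hLn (norm_nonneg a)
  have hga := mul_le_mul_of_nonneg_left hGl (by positivity : 0 ≤ ‖g‖ / 2)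
  linarith

theorem rightSlice_partialFunctional_eq_zero (hA : IsSimple A) (hπ : Function.Injective π)
    (hρ : Function.Injective ρ) {C : NonUnitalStarSubalgebra ℂ
      (HilbertTensor H K →L[ℂ] HilbertTensor H K)} (hC : C ≤ minTensor π ρ)
    (hAC : ∀ (a : A), ∀ c ∈ C, opTensor (π a) (1 : K →L[ℂ] K) * c ∈ C ∧
      c * opTensor (π a) (1 : K →L[ℂ] K) ∈ C)
    (f : (HilbertTensor H K →L[ℂ] HilbertTensor H K) →L[ℂ] ℂ) (hf : ∀ c ∈ C, f c = 0)
    (d : A) (c : minTensor π ρ) (hc : (c : HilbertTensor H K →L[ℂ] HilbertTensor H K) ∈ C) :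
    rightSlice π ρ (partialFunctional π ρ f (d * star d)) c = 0 := by
  by_contra hy
  set ψ := partialFunctional π ρ f (d * star d) with hψ
  set y := rightSlice π ρ ψ c with hydef
  -- Multiplying by `y⋆ ⊗ 1` turns the slice `y` into the positive element `y⋆ y`.
  have hc' := (hAC (star y) c hc).1
  let c' : minTensor π ρ := ⟨_, hC hc'⟩
  have hyc : rightSlice π ρ ψ c' = star y * y := rightSlice_mul_left hπ hρ ψ (star y) c c' rfl
  have hpos : 0 < ‖star y * y‖ := by
    rw [CStarRing.norm_star_mul_self]
    have := norm_pos_iff.2 hy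
    positivity
  have key : ∀ δ > 0, ‖star y * y‖ / 2 * ‖d * star d‖ ≤
      (‖ψ‖ * δ) * ‖d * star d‖ + ‖f‖ * (δ * ‖d * star d‖) * ‖d * star d‖ := by
    intro δ hδ
    obtain ⟨_, ⟨z, rfl⟩, hz⟩ := Metric.mem_closure_iff.1 (denseRange_tensorIncl π ρ c') δ hδ
    obtain ⟨ι, _, x, b, hx, rfl⟩ := exists_sum_selfAdjoint_tmul z
    rw [dist_eq_norm] at hz
    -- First `ε → 0` with the tensor fixed, since the norms of the `b i` are not controlled as `δ`
    -- shrinks; then `δ → 0`.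
    have h := le_of_forall_pos_le
      (p := fun ε => ‖star y * y‖ / 2 * (‖d * star d‖ - ε))
      (q := fun ε => (‖ψ‖ * δ) * (‖d * star d‖ + ε) + (∑ i, ‖ψ (b i)‖) * ε
        + ‖f‖ * (ε * ∑ i, ‖b i‖ + δ * (‖d * star d‖ + ε)) * ‖d * star d‖)
      (by fun_prop) (by fun_prop)
      (fun ε hε => averaging_estimate hA hπ hρ hAC f hf d c' hc' hy hyc x b hx hz.le hε)
    simpa using h
  have h0 := le_of_forall_pos_le (p := fun _ => ‖star y * y‖ / 2 * ‖d * star d‖)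
    (q := fun δ => (‖ψ‖ * δ) * ‖d * star d‖ + ‖f‖ * (δ * ‖d * star d‖) * ‖d * star d‖)
    (by fun_prop) (by fun_prop) key
  simp only [mul_zero, zero_mul, add_zero] at h0
  have ha : ‖d * star d‖ = 0 := by
    by_contra hne
    have : 0 < ‖d * star d‖ := lt_of_le_of_ne (norm_nonneg _) (Ne.symm hne)
    nlinarith
  -- The limit inequality leaves only `d d⋆ = 0`, in which case `ψ` itself vanishes.
  have hψ0 : ψ = 0 := by
    ext b
    rw [hψ, partialFunctional_apply, norm_eq_zero.1 ha, map_zero, ← opTensorLeft_apply, map_zero,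
      map_zero, zero_apply]
  apply hy
  rw [hydef, ← norm_le_zero_iff]
  refine (norm_rightSlice_le hπ hρ ψ c).trans ?_
  rw [hψ0, norm_zero, zero_mul]

/-- A C⋆-algebra is spanned by the elements `d d⋆`. -/
theorem mem_span_mul_star (a : A) :
    a ∈ Submodule.span ℂ (Set.range fun d : A => d * star d) := by
  let _ := CStarAlgebra.spectralOrder A
  have := CStarAlgebra.spectralOrderedRing A
  have hnn : ∀ p : A, 0 ≤ p → p ∈ Submodule.span ℂ (Set.range fun d : A => d * star d) := by
    intro p hp
    obtain ⟨y, rfl⟩ := CStarAlgebra.nonneg_iff_eq_mul_star_self.1 hp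
    exact Submodule.subset_span ⟨y, rfl⟩
  have hsa : ∀ p : A, IsSelfAdjoint p →
      p ∈ Submodule.span ℂ (Set.range fun d : A => d * star d) := by
    intro p hp
    rw [← CFC.posPart_sub_negPart p hp]
    exact sub_mem (hnn _ (CFC.posPart_nonneg p)) (hnn _ (CFC.negPart_nonneg p))
  rw [← realPart_add_I_smul_imaginaryPart a]
  exact add_mem (hsa _ (realPart a).2) (Submodule.smul_mem _ _ (hsa _ (imaginaryPart a).2))

/-- Hahn–Banach in the normed quotient `E ⧸ p`. -/
theorem exists_dual_eq_zero_of_notMem {E : Type*} [NormedAddCommGroup E] [NormedSpace ℂ E]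
    {p : Submodule ℂ E} (hp : IsClosed (p : Set E)) {x : E} (hx : x ∉ p) :
    ∃ f : E →L[ℂ] ℂ, (∀ y ∈ p, f y = 0) ∧ f x ≠ 0 := by
  have : IsClosed (p : Set E) := hp
  have hx' : (p.mkQ x : E ⧸ p) ≠ 0 := by
    rwa [Submodule.mkQ_apply, Ne, Submodule.Quotient.mk_eq_zero]
  obtain ⟨g, hg⟩ := SeparatingDual.exists_ne_zero (R := ℂ) hx'
  refine ⟨g ∘L p.mkQL, fun y hy => ?_, hg⟩
  have : p.mkQL y = 0 := by
    rwa [Submodule.mkQL_apply, Submodule.mkQ_apply, Submodule.Quotient.mk_eq_zero]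
  rw [ContinuousLinearMap.comp_apply, this, map_zero]

/-- If `C` is invariant under multiplication by `A`, then `a ⊗ (φ ⊗ id)(c)` is in `C`. -/
theorem opTensor_slice_mem (hA : IsSimple A) (hπ : Function.Injective π)
    (hρ : Function.Injective ρ) {C : NonUnitalStarSubalgebra ℂ
      (HilbertTensor H K →L[ℂ] HilbertTensor H K)}
    (hCclosed : IsClosed (C : Set (HilbertTensor H K →L[ℂ] HilbertTensor H K)))
    (hC : C ≤ minTensor π ρ)
    (hAC : ∀ (a : A), ∀ c ∈ C, opTensor (π a) (1 : K →L[ℂ] K) * c ∈ C ∧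
      c * opTensor (π a) (1 : K →L[ℂ] K) ∈ C)
    (c : minTensor π ρ) (hc : (c : HilbertTensor H K →L[ℂ] HilbertTensor H K) ∈ C)
    (φ : A →L[ℂ] ℂ) (a : A) : opTensor (π a) (ρ (slice π ρ φ c)) ∈ C := by
  have ha := mem_span_mul_star a
  induction ha using Submodule.span_induction with
  | mem a ha =>
    obtain ⟨d, rfl⟩ := ha
    by_contra hx
    obtain ⟨f, hf, hfx⟩ := exists_dual_eq_zero_of_notMem (p := C.toSubmodule) hCclosed hx
    refine hfx ?_
    have h := rightSlice_partialFunctional_eq_zero hA hπ hρ hC hAC f hf d c hc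
    rw [← partialFunctional_apply, ← apply_rightSlice hπ hρ, h, map_zero]
  | zero =>
    rw [map_zero, ← opTensorLeft_apply, map_zero]
    exact zero_mem C
  | add a a' _ _ h h' =>
    rw [map_add, ← opTensorLeft_apply, map_add]
    exact add_mem h h'
  | smul r a _ h =>
    rw [map_smul, ← opTensorLeft_apply, map_smul]
    exact SMulMemClass.smul_mem r h

/-- The elements `b` of `B` with `A ⊗ b ⊆ C`. -/
def coefficientAlgebra (π : A →⋆ₙₐ[ℂ] (H →L[ℂ] H)) (ρ : B →⋆ₙₐ[ℂ] (K →L[ℂ] K))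
    (C : NonUnitalStarSubalgebra ℂ (HilbertTensor H K →L[ℂ] HilbertTensor H K)) :
    NonUnitalStarSubalgebra ℂ B where
  carrier := {b | ∀ a, opTensor (π a) (ρ b) ∈ C}
  zero_mem' a := by
    rw [← opTensorRep_apply, map_zero]
    exact zero_mem C
  add_mem' hb hb' a := by
    rw [← opTensorRep_apply, map_add]
    exact add_mem (hb a) (hb' a)
  smul_mem' r b hb a := by
    rw [← opTensorRep_apply, map_smul]
    exact SMulMemClass.smul_mem r (hb a)
  mul_mem' := by
    intro b b' hb hb' a
    have ha := mem_span_mul_star a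
    induction ha using Submodule.span_induction with
    | mem a ha =>
      obtain ⟨d, rfl⟩ := ha
      -- Factoring `a = d d⋆` gives `a ⊗ b b' = (d ⊗ b)(d⋆ ⊗ b')`, a product inside `C`.
      rw [map_mul, map_mul, ← opTensor_mul]
      exact mul_mem (hb _) (hb' _)
    | zero =>
      rw [map_zero, ← opTensorLeft_apply, map_zero]
      exact zero_mem C
    | add a a' _ _ h h' =>
      rw [map_add, ← opTensorLeft_apply, map_add]
      exact add_mem h h'
    | smul r a _ h =>
      rw [map_smul, ← opTensorLeft_apply, map_smul]
      exact SMulMemClass.smul_mem r h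
  star_mem' := by
    intro b hb a
    have := star_mem (hb (star a))
    rwa [star_opTensor, ← map_star, ← map_star, star_star] at this

theorem isClosed_coefficientAlgebra {C : NonUnitalStarSubalgebra ℂ
      (HilbertTensor H K →L[ℂ] HilbertTensor H K)}
    (hCclosed : IsClosed (C : Set (HilbertTensor H K →L[ℂ] HilbertTensor H K))) :
    IsClosed (coefficientAlgebra π ρ C : Set B) := by
  have : (coefficientAlgebra π ρ C : Set B) = ⋂ a, opTensorRep ρ (π a) ⁻¹' C := by
    ext b
    rw [Set.mem_iInter]
    rfl
  rw [this]
  exact isClosed_iInter fun a => hCclosed.preimage (opTensorRep ρ (π a)).continuous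

/-- The slices of `C` form a C⋆-subalgebra `S` of `B` with `A ⊗ S ⊆ C`. -/
theorem exists_subalgebra_eq_sliceSet (hA : IsSimple A) (hπ : Function.Injective π)
    (hρ : Function.Injective ρ) {C : NonUnitalStarSubalgebra ℂ
      (HilbertTensor H K →L[ℂ] HilbertTensor H K)}
    (hCclosed : IsClosed (C : Set (HilbertTensor H K →L[ℂ] HilbertTensor H K)))
    (hC : C ≤ minTensor π ρ)
    (hAC : ∀ (a : A), ∀ c ∈ C, opTensor (π a) (1 : K →L[ℂ] K) * c ∈ C ∧
      c * opTensor (π a) (1 : K →L[ℂ] K) ∈ C) :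
    ∃ S : NonUnitalStarSubalgebra ℂ B, (S : Set B) = sliceSet π ρ C ∧ IsClosed (S : Set B) ∧
      ∀ s ∈ S, ∀ a, opTensor (π a) (ρ s) ∈ C := by
  -- For `A = 0` every `b` satisfies `A ⊗ b ⊆ C`, but the only slice is `0`, so this case is
  -- separate.
  rcases subsingleton_or_nontrivial A with hsub | hnt
  · refine ⟨⊥, ?_, ?_, ?_⟩
    · rw [NonUnitalStarAlgebra.coe_bot]
      refine Set.eq_of_subset_of_subset ?_ ?_
      · rintro _ rfl
        exact ⟨0, 0, zero_mem C, map_zero _⟩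
      · rintro _ ⟨φ, c, -, rfl⟩
        have hφ : φ = 0 := by
          ext a
          rw [Subsingleton.elim a 0, map_zero, map_zero]
        have := norm_slice_le hπ hρ φ c
        rw [hφ, norm_zero, zero_mul, norm_le_zero_iff] at this
        rw [hφ, this, Set.mem_singleton_iff]
    · rw [NonUnitalStarAlgebra.coe_bot]
      exact isClosed_singleton
    · intro s _ a
      rw [Subsingleton.elim a 0, map_zero, ← opTensorLeft_apply, map_zero]
      exact zero_mem C
  · refine ⟨coefficientAlgebra π ρ C, ?_, isClosed_coefficientAlgebra hCclosed, fun s hs => hs⟩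
    refine Set.eq_of_subset_of_subset ?_ ?_
    · intro b hb
      obtain ⟨a, ha⟩ := exists_ne (0 : A)
      obtain ⟨φ, hφ⟩ := SeparatingDual.exists_eq_one (R := ℂ) ha
      refine ⟨φ, tensorIncl π ρ (a ⊗ₜ b), hb a, ?_⟩
      rw [slice_tensorIncl hπ hρ, algSlice_tmul, hφ, one_smul]
    · rintro _ ⟨φ, c, hc, rfl⟩ a
      exact opTensor_slice_mem hA hπ hρ hCclosed hC hAC c hc φ a

end KeyClaim

/-! ### Matrices over `B` as operators on `Kⁿ`. -/

section MatrixOperators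

open scoped InnerProductSpace

variable {K : Type*} [NormedAddCommGroup K] [InnerProductSpace ℂ K] [CompleteSpace K]
  {n : ℕ}

/-- The operator on `Kⁿ` given by a matrix of operators on `K`. -/
def matOp (T : Fin n → Fin n → K →L[ℂ] K) :
    PiLp 2 (fun _ : Fin n => K) →L[ℂ] PiLp 2 (fun _ : Fin n => K) :=
  ∑ i, ∑ j, (PiLp.proj (𝕜 := ℂ) 2 (fun _ : Fin n => K) i).adjoint ∘L T i j ∘L
    PiLp.proj (𝕜 := ℂ) 2 (fun _ : Fin n => K) j

theorem inner_matOp (T : Fin n → Fin n → K →L[ℂ] K) (ξ η : PiLp 2 (fun _ : Fin n => K)) :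
    ⟪η, matOp T ξ⟫_ℂ = ∑ i, ∑ j, ⟪η i, T i j (ξ j)⟫_ℂ := by
  simp only [matOp, sum_apply, inner_sum, ContinuousLinearMap.comp_apply,
    ContinuousLinearMap.adjoint_inner_right, PiLp.proj_apply]

theorem matOp_apply (T : Fin n → Fin n → K →L[ℂ] K) (ξ : PiLp 2 (fun _ : Fin n => K)) (i : Fin n) :
    matOp T ξ i = ∑ j, T i j (ξ j) := by
  have h : matOp T ξ = WithLp.toLp 2 fun i => ∑ j, T i j (ξ j) := by
    refine ext_inner_left ℂ fun η => ?_
    rw [inner_matOp, PiLp.inner_apply]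
    simp only [inner_sum]
  rw [h]

theorem continuous_matOp :
    Continuous (matOp : (Fin n → Fin n → K →L[ℂ] K) → _) := by
  unfold matOp
  fun_prop

theorem star_matOp (T : Fin n → Fin n → K →L[ℂ] K) :
    star (matOp T) = matOp fun i j => star (T j i) := by
  refine ContinuousLinearMap.ext fun ξ => ext_inner_left ℂ fun η => ?_
  rw [ContinuousLinearMap.star_eq_adjoint, ContinuousLinearMap.adjoint_inner_right, inner_matOp,
    ← inner_conj_symm, inner_matOp, map_sum, Finset.sum_comm]
  simp only [map_sum, inner_conj_symm, ContinuousLinearMap.star_eq_adjoint,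
    ContinuousLinearMap.adjoint_inner_right]

variable {B : Type*} [NonUnitalCStarAlgebra B]

/-- The representation of `Mₙ(B)` on `Kⁿ` given by a representation of `B` on `K`. -/
def matRep (ρ : B →⋆ₙₐ[ℂ] (K →L[ℂ] K)) (n : ℕ) :
    CStarMatrix (Fin n) (Fin n) B →⋆ₙₐ[ℂ]
      (PiLp 2 (fun _ : Fin n => K) →L[ℂ] PiLp 2 (fun _ : Fin n => K)) where
  toFun t := matOp fun i j => ρ (t i j)
  map_smul' r t := by
    ext ξ i
    simp [matOp_apply, Finset.smul_sum]
  map_zero' := by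
    ext ξ i
    simp [matOp_apply]
  map_add' s t := by
    ext ξ i
    simp [matOp_apply, Finset.sum_add_distrib]
  map_mul' s t := by
    ext ξ i
    simp only [matOp_apply, CStarMatrix.mul_apply, map_sum, map_mul, sum_apply,
      mul_apply_eq_comp]
    rw [Finset.sum_comm]
  map_star' t := by
    rw [star_matOp]
    simp only [CStarMatrix.star_apply, map_star]

theorem matRep_apply (ρ : B →⋆ₙₐ[ℂ] (K →L[ℂ] K)) (t : CStarMatrix (Fin n) (Fin n) B) :
    matRep ρ n t = matOp fun i j => ρ (t i j) := rfl

theorem matRep_injective {ρ : B →⋆ₙₐ[ℂ] (K →L[ℂ] K)} (hρ : Function.Injective ρ) :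
    Function.Injective (matRep ρ n) := by
  intro s t hst
  refine CStarMatrix.ext fun i j => hρ (ContinuousLinearMap.ext fun k => ?_)
  have h := congrArg (fun T => T (WithLp.toLp 2 (Pi.single j k)) i) hst
  simpa [matRep_apply, matOp_apply, Pi.single_apply, apply_ite] using h

end MatrixOperators

/-! ### The norm on `A ⊗ B` computed from matrices of slices. -/

section NormFormula

open scoped InnerProductSpace

variable {H K : Type*} [NormedAddCommGroup H] [InnerProductSpace ℂ H]
  [NormedAddCommGroup K] [InnerProductSpace ℂ K] {n : ℕ}

/-- The operator `ξ ↦ ∑ eⱼ ⊗ ξⱼ`. -/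
def frameMap (K : Type*) [NormedAddCommGroup K] [InnerProductSpace ℂ K] (e : Fin n → H) :
    PiLp 2 (fun _ : Fin n => K) →L[ℂ] HilbertTensor H K :=
  ∑ j, ((toHilbertTensor H K).toContinuousLinearMap ∘L TensorProduct.mkL ℂ H K (e j)) ∘L
    PiLp.proj (𝕜 := ℂ) 2 (fun _ : Fin n => K) j

theorem frameMap_apply (e : Fin n → H) (ξ : PiLp 2 (fun _ : Fin n => K)) :
    frameMap K e ξ = ∑ j, toHilbertTensor H K (e j ⊗ₜ ξ j) := by
  simp only [frameMap, sum_apply]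
  rfl

theorem norm_frameMap {e : Fin n → H} (he : Orthonormal ℂ e) (ξ : PiLp 2 (fun _ : Fin n => K)) :
    ‖frameMap K e ξ‖ = ‖ξ‖ := by
  have h : ⟪frameMap K e ξ, frameMap K e ξ⟫_ℂ = ⟪ξ, ξ⟫_ℂ := by
    simp only [frameMap_apply, sum_inner, inner_sum, inner_toHilbertTensor_tmul,
      orthonormal_iff_ite.1 he, ite_mul, one_mul, zero_mul, PiLp.inner_apply]
    simp
  rw [inner_self_eq_norm_sq_to_K, inner_self_eq_norm_sq_to_K] at h
  have h' : ‖frameMap K e ξ‖ ^ 2 = ‖ξ‖ ^ 2 := by exact_mod_cast h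
  exact (sq_eq_sq₀ (norm_nonneg _) (norm_nonneg _)).1 h'

theorem inner_frameMap (e : Fin n → H) (X : HilbertTensor H K →L[ℂ] HilbertTensor H K)
    (ξ η : PiLp 2 (fun _ : Fin n => K)) :
    ⟪frameMap K e η, X (frameMap K e ξ)⟫_ℂ
      = ∑ i, ∑ j, ⟪toHilbertTensor H K (e i ⊗ₜ η i), X (toHilbertTensor H K (e j ⊗ₜ ξ j))⟫_ℂ := by
  simp only [frameMap_apply, map_sum, inner_sum, sum_inner]
  exact Finset.sum_comm

/-- Two algebraic tensors can be written over a common finite orthonormal family. -/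
theorem exists_frameMap_eq (x y : H ⊗[ℂ] K) :
    ∃ (n : ℕ) (e : Fin n → H), Orthonormal ℂ e ∧
      toHilbertTensor H K x ∈ Set.range (frameMap K e) ∧
      toHilbertTensor H K y ∈ Set.range (frameMap K e) := by
  obtain ⟨F, hF, hs⟩ := TensorProduct.exists_finite_submodule_left_of_setFinite {x, y}
    (Set.toFinite _)
  let b := stdOrthonormalBasis ℂ F
  have he : Orthonormal ℂ fun i => (b i : H) := by
    have := b.orthonormal.comp_linearIsometry F.subtypeₗᵢ
    exact this
  have key : ∀ z ∈ LinearMap.range (F.subtype.rTensor K),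
      toHilbertTensor H K z ∈ Set.range (frameMap K fun i => (b i : H)) := by
    rintro _ ⟨z, rfl⟩
    change _ ∈ (frameMap K fun i => (b i : H)).toLinearMap.range
    induction z with
    | zero => simp
    | add z z' hz hz' => rw [map_add, map_add]; exact add_mem hz hz'
    | tmul f k =>
      refine ⟨WithLp.toLp 2 fun i => (b.repr f i) • k, ?_⟩
      rw [ContinuousLinearMap.coe_coe, frameMap_apply, LinearMap.rTensor_tmul]
      conv_rhs => rw [← b.sum_repr f]
      simp only [map_sum, map_smul, Submodule.subtype_apply, TensorProduct.sum_tmul,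
        TensorProduct.smul_tmul', TensorProduct.tmul_smul]
  exact ⟨_, _, he, key x (hs (by simp)), key y (hs (by simp))⟩

/-- Algebraic tensors are dense, and any two of them lie in the range of a single isometric frame
map. -/
theorem norm_le_of_frameMap {X : HilbertTensor H K →L[ℂ] HilbertTensor H K} {r : ℝ} (hr : 0 ≤ r)
    (h : ∀ (n : ℕ) (e : Fin n → H), Orthonormal ℂ e → ∀ ξ η : PiLp 2 (fun _ : Fin n => K),
      ‖⟪frameMap K e η, X (frameMap K e ξ)⟫_ℂ‖ ≤ r * (‖η‖ * ‖ξ‖)) : ‖X‖ ≤ r := by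
  refine norm_le_of_inner_le hr fun ξ η => ?_
  refine denseRange_toHilbertTensor.induction_on₂
    (p := fun ξ η => ‖⟪η, X ξ⟫_ℂ‖ ≤ r * (‖η‖ * ‖ξ‖))
    (isClosed_le (by fun_prop) (by fun_prop)) (fun x y => ?_) ξ η
  obtain ⟨n, e, he, ⟨ξ, hξ⟩, η, hη⟩ := exists_frameMap_eq x y
  rw [← hξ, ← hη, norm_frameMap he, norm_frameMap he]
  exact h n e he ξ η

variable [CompleteSpace H] [CompleteSpace K]
  {A B : Type*} [NonUnitalCStarAlgebra A] [NonUnitalCStarAlgebra B]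
  {π : A →⋆ₙₐ[ℂ] (H →L[ℂ] H)} {ρ : B →⋆ₙₐ[ℂ] (K →L[ℂ] K)}

variable (π ρ) in
/-- The matrix of slices of an element of `A ⊗ B` by the vector functionals of a finite family. -/
def sliceMatrix (e : Fin n → H) (x : minTensor π ρ) : CStarMatrix (Fin n) (Fin n) B :=
  CStarMatrix.ofMatrix fun i j => slice π ρ (vecFunctional (e j) (e i) ∘L repL π) x

theorem inner_frameMap_eq (hπ : Function.Injective π) (hρ : Function.Injective ρ)
    (e : Fin n → H) (x : minTensor π ρ) (ξ η : PiLp 2 (fun _ : Fin n => K)) :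
    ⟪frameMap K e η, (x : HilbertTensor H K →L[ℂ] HilbertTensor H K) (frameMap K e ξ)⟫_ℂ
      = ⟪η, matRep ρ n (sliceMatrix π ρ e x) ξ⟫_ℂ := by
  rw [inner_frameMap, matRep_apply, inner_matOp]
  simp only [inner_eq_inner_slice hπ hρ]
  rfl

/-- For an orthonormal family the slice matrix is the compression of `x` along the isometry
`frameMap`. With `norm_le_of_matRep_sliceMatrix`, this makes `‖x‖` the supremum of the norms of
slice matrices. -/
theorem norm_matRep_sliceMatrix_le (hπ : Function.Injective π) (hρ : Function.Injective ρ)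
    {e : Fin n → H} (he : Orthonormal ℂ e) (x : minTensor π ρ) :
    ‖matRep ρ n (sliceMatrix π ρ e x)‖ ≤ ‖x‖ := by
  refine norm_le_of_inner_le (norm_nonneg _) fun ξ η => ?_
  rw [← inner_frameMap_eq hπ hρ]
  refine (norm_inner_le_norm _ _).trans ?_
  rw [norm_frameMap he]
  have := (x : HilbertTensor H K →L[ℂ] HilbertTensor H K).le_opNorm (frameMap K e ξ)
  rw [norm_frameMap he] at this
  calc _ ≤ ‖η‖ * (‖(x : HilbertTensor H K →L[ℂ] HilbertTensor H K)‖ * ‖ξ‖) := by gcongr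
    _ = ‖(x : HilbertTensor H K →L[ℂ] HilbertTensor H K)‖ * (‖η‖ * ‖ξ‖) := by ring

theorem norm_le_of_matRep_sliceMatrix (hπ : Function.Injective π) (hρ : Function.Injective ρ)
    {x : minTensor π ρ} {r : ℝ} (hr : 0 ≤ r)
    (h : ∀ (n : ℕ) (e : Fin n → H), Orthonormal ℂ e → ‖matRep ρ n (sliceMatrix π ρ e x)‖ ≤ r) :
    ‖x‖ ≤ r := by
  refine norm_le_of_frameMap (X := (x : HilbertTensor H K →L[ℂ] HilbertTensor H K)) hr
    fun n e he ξ η => ?_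
  rw [inner_frameMap_eq hπ hρ]
  refine (norm_inner_le_norm _ _).trans ?_
  have := (matRep ρ n (sliceMatrix π ρ e x)).le_of_opNorm_le (h n e he) ξ
  calc _ ≤ ‖η‖ * (r * ‖ξ‖) := by gcongr
    _ = _ := by ring

end NormFormula

/-! ### The subalgebra `A ⊗ S` of `A ⊗ B`. -/

section Subalgebra

variable {A B H K : Type*} [NonUnitalCStarAlgebra A] [NonUnitalCStarAlgebra B]
  [NormedAddCommGroup H] [InnerProductSpace ℂ H] [CompleteSpace H]
  [NormedAddCommGroup K] [InnerProductSpace ℂ K] [CompleteSpace K]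
  {π : A →⋆ₙₐ[ℂ] (H →L[ℂ] H)} {ρ : B →⋆ₙₐ[ℂ] (K →L[ℂ] K)}

theorem opTensor_mem_minTensor_subtype {S : NonUnitalStarSubalgebra ℂ B} (a : A) {s : B}
    (hs : s ∈ S) :
    opTensor (π a) (ρ s) ∈ minTensor π (ρ.comp (NonUnitalStarSubalgebraClass.subtype S)) :=
  tensorRep_mem π (ρ.comp (NonUnitalStarSubalgebraClass.subtype S)) (a ⊗ₜ (⟨s, hs⟩ : S))

theorem minTensor_subtype_le {S : NonUnitalStarSubalgebra ℂ B}
    {C : NonUnitalStarSubalgebra ℂ (HilbertTensor H K →L[ℂ] HilbertTensor H K)}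
    (hCclosed : IsClosed (C : Set (HilbertTensor H K →L[ℂ] HilbertTensor H K)))
    (h : ∀ s ∈ S, ∀ a, opTensor (π a) (ρ s) ∈ C) :
    minTensor π (ρ.comp (NonUnitalStarSubalgebraClass.subtype S)) ≤ C := by
  refine NonUnitalStarSubalgebra.topologicalClosure_minimal _
    (NonUnitalStarAlgebra.adjoin_le ?_) hCclosed
  rintro _ ⟨a, s, rfl⟩
  exact h s s.2 a

end Subalgebra

/-! ### The case of a completely bounded projection. -/

section CompletelyBounded

variable {A B H K : Type*} [NonUnitalCStarAlgebra A] [NonUnitalCStarAlgebra B]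
  [NormedAddCommGroup H] [InnerProductSpace ℂ H] [CompleteSpace H]
  [NormedAddCommGroup K] [InnerProductSpace ℂ K] [CompleteSpace K]
  {π : A →⋆ₙₐ[ℂ] (H →L[ℂ] H)} {ρ : B →⋆ₙₐ[ℂ] (K →L[ℂ] K)}

/-- Complete boundedness in terms of a faithful representation. -/
theorem IsCompletelyBounded.exists_norm_matRep_le {P : B →ₗ[ℂ] B} (hP : IsCompletelyBounded P)
    (hρ : Function.Injective ρ) :
    ∃ M : ℝ, 0 ≤ M ∧ ∀ (n : ℕ) (t : CStarMatrix (Fin n) (Fin n) B),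
      ‖matRep ρ n (t.map P)‖ ≤ M * ‖matRep ρ n t‖ := by
  let _ := CStarAlgebra.spectralOrder B
  have := CStarAlgebra.spectralOrderedRing B
  obtain ⟨M, hM⟩ := hP
  refine ⟨|M|, abs_nonneg M, fun n t => ?_⟩
  rw [NonUnitalStarAlgHom.norm_map _ (matRep_injective hρ),
    NonUnitalStarAlgHom.norm_map _ (matRep_injective hρ)]
  exact (hM n t).trans (mul_le_mul_of_nonneg_right (le_abs_self M) (norm_nonneg _))

theorem norm_le_norm_matRep (hρ : Function.Injective ρ) {n : ℕ}
    (t : CStarMatrix (Fin n) (Fin n) B) (i j : Fin n) : ‖t i j‖ ≤ ‖matRep ρ n t‖ := by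
  let _ := CStarAlgebra.spectralOrder B
  have := CStarAlgebra.spectralOrderedRing B
  rw [NonUnitalStarAlgHom.norm_map _ (matRep_injective hρ)]
  exact CStarMatrix.norm_entry_le_norm

theorem norm_matRep_one_le (b : B) :
    ‖matRep ρ 1 (CStarMatrix.ofMatrix fun _ _ => b)‖ ≤ ‖b‖ := by
  refine norm_le_of_inner_le (norm_nonneg _) fun ξ η => ?_
  rw [matRep_apply, inner_matOp]
  simp only [Finset.univ_unique, Finset.sum_singleton]
  refine (norm_inner_le_norm _ _).trans ?_
  have h1 := (ρ b).le_of_opNorm_le (NonUnitalStarAlgHom.norm_apply_le ρ b) (ξ default)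
  have h2 := PiLp.norm_apply_le ξ default
  have h3 := PiLp.norm_apply_le η default
  calc _ ≤ ‖η‖ * (‖b‖ * ‖ξ‖) := by
        refine mul_le_mul h3 (h1.trans ?_) (norm_nonneg _) (norm_nonneg _)
        gcongr
    _ = _ := by ring

theorem norm_apply_le_of_norm_matRep_le {P : B →ₗ[ℂ] B} (hρ : Function.Injective ρ) {M : ℝ} (hM0 : 0 ≤ M)
    (hM : ∀ (n : ℕ) (t : CStarMatrix (Fin n) (Fin n) B),
      ‖matRep ρ n (t.map P)‖ ≤ M * ‖matRep ρ n t‖) (b : B) : ‖P b‖ ≤ M * ‖b‖ :=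
  (norm_le_norm_matRep hρ ((CStarMatrix.ofMatrix fun _ _ => b).map P) 0 0).trans <|
    (hM 1 _).trans <| by gcongr; exact norm_matRep_one_le b

theorem algSlice_lTensor (P : B →ₗ[ℂ] B) (φ : A →L[ℂ] ℂ) (z : A ⊗[ℂ] B) :
    algSlice B φ (LinearMap.lTensor A P z) = P (algSlice B φ z) := by
  induction z with
  | zero => simp
  | add x y hx hy => simp only [map_add, hx, hy]
  | tmul a b => rw [LinearMap.lTensor_tmul, algSlice_tmul, algSlice_tmul, map_smul]

/-- A completely bounded map `P` on `B` induces a bounded map `id ⊗ P`. -/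
theorem norm_tensorIncl_lTensor_le (hπ : Function.Injective π) (hρ : Function.Injective ρ)
    {P : B →ₗ[ℂ] B} {M : ℝ} (hM0 : 0 ≤ M)
    (hM : ∀ (n : ℕ) (t : CStarMatrix (Fin n) (Fin n) B),
      ‖matRep ρ n (t.map P)‖ ≤ M * ‖matRep ρ n t‖) (z : A ⊗[ℂ] B) :
    ‖tensorIncl π ρ (LinearMap.lTensor A P z)‖ ≤ M * ‖tensorIncl π ρ z‖ := by
  refine norm_le_of_matRep_sliceMatrix hπ hρ (by positivity) fun n e he => ?_
  have h : sliceMatrix π ρ e (tensorIncl π ρ (LinearMap.lTensor A P z))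
      = (sliceMatrix π ρ e (tensorIncl π ρ z)).map P := by
    refine CStarMatrix.ext fun i j => ?_
    simp only [sliceMatrix, CStarMatrix.map_apply, slice_tensorIncl hπ hρ, algSlice_lTensor]
    rfl
  rw [h]
  refine (hM n _).trans ?_
  gcongr
  exact norm_matRep_sliceMatrix_le hπ hρ he _

theorem tensorRep_lTensor_mem {P : B →ₗ[ℂ] B} {S : NonUnitalStarSubalgebra ℂ B}
    (hPS : ∀ b, P b ∈ S) (z : A ⊗[ℂ] B) :
    tensorRep π ρ (LinearMap.lTensor A P z) ∈
      minTensor π (ρ.comp (NonUnitalStarSubalgebraClass.subtype S)) := by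
  induction z with
  | zero => simp
  | add x y hx hy => rw [map_add, map_add]; exact add_mem hx hy
  | tmul a b => exact opTensor_mem_minTensor_subtype a (hPS b)

theorem exists_extension_lTensor (hπ : Function.Injective π) (hρ : Function.Injective ρ)
    {P : B →ₗ[ℂ] B} {M : ℝ} (hM0 : 0 ≤ M)
    (hM : ∀ (n : ℕ) (t : CStarMatrix (Fin n) (Fin n) B),
      ‖matRep ρ n (t.map P)‖ ≤ M * ‖matRep ρ n t‖) :
    ∃ Q : minTensor π ρ →L[ℂ] minTensor π ρ,
      ∀ z, Q (tensorIncl π ρ z) = tensorIncl π ρ (LinearMap.lTensor A P z) := by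
  have : CompleteSpace (minTensor π ρ) := (isClosed_minTensor _ _).completeSpace_coe
  exact ⟨(tensorIncl π ρ ∘ₗ LinearMap.lTensor A P).extendOfNorm (tensorIncl π ρ),
    LinearMap.extendOfNorm_eq (denseRange_tensorIncl π ρ)
      ⟨M, norm_tensorIncl_lTensor_le hπ hρ hM0 hM⟩⟩

/-- If `S` is the range of a completely bounded projection, then every element of `A ⊗ B` whose
slices are in `S` belongs to `A ⊗ S`. -/
theorem mem_minTensor_subtype_of_hasCBProjection (hπ : Function.Injective π)
    (hρ : Function.Injective ρ) {S : NonUnitalStarSubalgebra ℂ B} (hS : HasCBProjection S)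
    (c : minTensor π ρ) (hc : ∀ φ, slice π ρ φ c ∈ S) :
    (c : HilbertTensor H K →L[ℂ] HilbertTensor H K) ∈
      minTensor π (ρ.comp (NonUnitalStarSubalgebraClass.subtype S)) := by
  obtain ⟨P, hPS, hPid, hP⟩ := hS
  obtain ⟨M, hM0, hM⟩ := hP.exists_norm_matRep_le hρ
  let PL : B →L[ℂ] B := P.mkContinuous M (norm_apply_le_of_norm_matRep_le hρ hM0 hM)
  obtain ⟨Q, hQ⟩ := exists_extension_lTensor (π := π) hπ hρ hM0 hM
  have hQmem : ∀ x, (Q x : HilbertTensor H K →L[ℂ] HilbertTensor H K) ∈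
      minTensor π (ρ.comp (NonUnitalStarSubalgebraClass.subtype S)) := by
    intro x
    refine (denseRange_tensorIncl π ρ).induction_on
      (p := fun x => (Q x : HilbertTensor H K →L[ℂ] HilbertTensor H K) ∈
        minTensor π (ρ.comp (NonUnitalStarSubalgebraClass.subtype S))) x ?_ fun z => ?_
    · exact (isClosed_minTensor _ _).preimage (continuous_subtype_val.comp Q.continuous)
    · rw [hQ, coe_tensorIncl]
      exact tensorRep_lTensor_mem hPS z
  have hQs : ∀ φ x, slice π ρ φ (Q x) = PL (slice π ρ φ x) := by
    intro φ x
    refine (denseRange_tensorIncl π ρ).induction_on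
      (p := fun x => slice π ρ φ (Q x) = PL (slice π ρ φ x)) x
      (isClosed_eq (by fun_prop) (by fun_prop)) fun z => ?_
    rw [hQ, slice_tensorIncl hπ hρ, slice_tensorIncl hπ hρ, algSlice_lTensor]
    rfl
  -- `Q c` and `c` have the same slices, as `P` fixes `S` pointwise.
  have hQc : Q c = c := ext_slice hπ hρ fun φ => (hQs φ c).trans (hPid _ (hc φ))
  rw [← hQc]
  exact hQmem c

end CompletelyBounded

/-! ### Countable norming sets and maps from `ℓ²`. -/

section Norming

open InnerProductSpace
open scoped InnerProductSpace

/-- A separable set of operators is normed by countably many vectors. -/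
theorem exists_countable_norming {E : Type*} [NormedAddCommGroup E] [InnerProductSpace ℂ E]
    {𝒯 : Set (E →L[ℂ] E)} (h𝒯 : TopologicalSpace.IsSeparable 𝒯) :
    ∃ D : Set E, D.Countable ∧ ∀ T ∈ 𝒯, ∀ r : ℝ, 0 ≤ r →
      (∀ ξ ∈ D, ∀ η ∈ D, ‖⟪η, T ξ⟫_ℂ‖ ≤ r * (‖η‖ * ‖ξ‖)) → ‖T‖ ≤ r := by
  obtain ⟨s, hs, hsT⟩ := h𝒯
  have hex : ∀ (T : E →L[ℂ] E) (q : ℚ), ∃ ξ, 0 ≤ (q : ℝ) → (q : ℝ) < ‖T‖ → q * ‖ξ‖ < ‖T ξ‖ := by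
    intro T q
    by_cases h : 0 ≤ (q : ℝ) ∧ (q : ℝ) < ‖T‖
    · by_contra! hne
      exact absurd (T.opNorm_le_bound h.1 fun ξ => (hne ξ).2.2) (not_le.2 h.2)
    · exact ⟨0, fun h0 h1 => absurd ⟨h0, h1⟩ h⟩
  choose ξ hξ using hex
  -- For `T` in a countable dense set and each rational `q < ‖T‖`, the vector `ξ` witnesses `‖T‖ >
  -- q`. Adding `T ξ` allows `‖T ξ‖²` to be read off as a matrix coefficient.
  refine ⟨⋃ T ∈ s, ⋃ q : ℚ, {ξ T q, T (ξ T q)}, ?_, fun T hT r hr hD => ?_⟩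
  · exact hs.biUnion fun T _ => Set.countable_iUnion fun q => (Set.toFinite _).countable
  · refine le_of_forall_pos_le_add fun ε hε => ?_
    obtain ⟨T', hT's, hTT'⟩ := Metric.mem_closure_iff.1 (hsT hT) (ε / 2) (by positivity)
    rw [dist_eq_norm] at hTT'
    have hT' : ‖T'‖ ≤ r + ε / 2 := by
      by_contra! hlt
      obtain ⟨q, hq1, hq2⟩ := exists_rat_btwn hlt
      have hq0 : 0 ≤ (q : ℝ) := by linarith
      have hlt' := hξ T' q hq0 hq2
      set v := ξ T' q with hv
      have hvD : v ∈ ⋃ T ∈ s, ⋃ q : ℚ, {ξ T q, T (ξ T q)} :=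
        Set.mem_biUnion hT's (Set.mem_iUnion.2 ⟨q, by simp [hv]⟩)
      have hvD' : T' v ∈ ⋃ T ∈ s, ⋃ q : ℚ, {ξ T q, T (ξ T q)} :=
        Set.mem_biUnion hT's (Set.mem_iUnion.2 ⟨q, by simp [hv]⟩)
      have h1 := hD v hvD (T' v) hvD'
      have h2 : ‖⟪T' v, (T' - T) v⟫_ℂ‖ ≤ ‖T' v‖ * (ε / 2 * ‖v‖) := by
        refine (norm_inner_le_norm _ _).trans ?_
        gcongr
        refine (T' - T).le_of_opNorm_le ?_ v
        rw [norm_sub_rev]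
        exact hTT'.le
      have h3 : ‖T' v‖ ^ 2 ≤ (r + ε / 2) * (‖T' v‖ * ‖v‖) := by
        have e : ⟪T' v, T' v⟫_ℂ = ⟪T' v, T v⟫_ℂ + ⟪T' v, (T' - T) v⟫_ℂ := by
          rw [← inner_add_right, sub_apply, add_sub_cancel]
        have h4 : ‖T' v‖ ^ 2 = ‖⟪T' v, T' v⟫_ℂ‖ := by
          rw [inner_self_eq_norm_sq_to_K]; simp
        rw [h4, e]
        refine (norm_add_le _ _).trans ((add_le_add h1 h2).trans (le_of_eq ?_))
        ring
      have hpos : 0 < ‖T' v‖ := lt_of_le_of_lt (by positivity) hlt'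
      have h5 : ‖T' v‖ ≤ (r + ε / 2) * ‖v‖ := by nlinarith
      have h6 : (r + ε / 2) * ‖v‖ ≤ q * ‖v‖ := by gcongr
      linarith
    have := norm_le_norm_add_norm_sub' T T'
    linarith

/-- A countable set of vectors lies isometrically in the image of `ℓ²`. -/
theorem exists_ellTwo_map {K : Type*} [NormedAddCommGroup K] [InnerProductSpace ℂ K]
    [CompleteSpace K] {D : Set K} (hD : D.Countable) :
    ∃ V : ellTwo →L[ℂ] K, ∀ k ∈ D, ∃ k', V k' = k ∧ ‖k'‖ = ‖k‖ := by
  classical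
  obtain ⟨f, hf⟩ := (hD.insert 0).exists_eq_range (Set.insert_nonempty _ _)
  let J : Set ℕ := {i | gramSchmidtNormed ℂ f i ≠ 0}
  have hJ : Orthonormal ℂ fun i : J => gramSchmidtNormed ℂ f i := gramSchmidtNormed_orthonormal' f
  let U := hJ.orthogonalFamily.linearIsometry
  have hstd : Orthonormal ℂ fun i : J => (default : HilbertBasis ℕ ℂ ellTwo) i :=
    (default : HilbertBasis ℕ ℂ ellTwo).orthonormal.comp _ Subtype.val_injective
  let I := hstd.orthogonalFamily.linearIsometry
  -- Gram–Schmidt may produce zeros or stop early, so `ℓ²(J)` is embedded into both `K` and `ℓ²`.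
  -- The resulting `V = U I⋆` is isometric on the range of `I`, where the lifts are taken.
  refine ⟨U.toContinuousLinearMap ∘L I.toContinuousLinearMap.adjoint, fun k hk => ?_⟩
  have hkU : k ∈ U.toLinearMap.range := by
    rw [OrthogonalFamily.range_linearIsometry]
    refine Submodule.le_topologicalClosure _ ?_
    have h1 : k ∈ Submodule.span ℂ (Set.range (gramSchmidtNormed ℂ f)) := by
      rw [span_gramSchmidtNormed_range, span_gramSchmidt, ← hf]
      exact Submodule.subset_span (Set.mem_insert_of_mem _ hk)
    refine (Submodule.span_le.2 ?_) h1
    rintro _ ⟨i, rfl⟩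
    by_cases hi : gramSchmidtNormed ℂ f i = 0
    · rw [hi]; exact zero_mem _
    · refine Submodule.mem_iSup_of_mem (⟨i, hi⟩ : J) ⟨(1 : ℂ), ?_⟩
      simp
  obtain ⟨x, rfl⟩ := hkU
  refine ⟨I x, ?_, ?_⟩
  · have h : I.toContinuousLinearMap.adjoint (I x) = x := by
      refine ext_inner_left ℂ fun y => ?_
      rw [ContinuousLinearMap.adjoint_inner_right]
      exact I.inner_map_map y x
    rw [ContinuousLinearMap.comp_apply, h]
    rfl
  · rw [I.norm_map]
    exact (U.norm_map x).symm

end Norming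

/-! ### Compression by `1 ⊗ V`. -/

section Compression

open scoped InnerProductSpace

variable {H K L : Type*} [NormedAddCommGroup H] [InnerProductSpace ℂ H]
  [NormedAddCommGroup K] [InnerProductSpace ℂ K]
  [NormedAddCommGroup L] [InnerProductSpace ℂ L]

variable (H) in
/-- The operator `1 ⊗ V`. -/
def idTensor (V : L →L[ℂ] K) : HilbertTensor H L →L[ℂ] HilbertTensor H K :=
  (V.lTensor H).completion

theorem idTensor_tmul (V : L →L[ℂ] K) (h : H) (l : L) :
    idTensor H V (toHilbertTensor H L (h ⊗ₜ l)) = toHilbertTensor H K (h ⊗ₜ V l) :=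
  ContinuousLinearMap.completion_apply_coe _ _

theorem idTensor_frameMap (V : L →L[ℂ] K) {n : ℕ} (e : Fin n → H)
    (ξ : PiLp 2 (fun _ : Fin n => L)) :
    idTensor H V (frameMap L e ξ) = frameMap K e (WithLp.toLp 2 fun i => V (ξ i)) := by
  simp only [frameMap_apply, map_sum, idTensor_tmul]

variable [CompleteSpace K] [CompleteSpace L]

/-- The compression `T ↦ V⋆ T V`. -/
def compress (V : L →L[ℂ] K) : (K →L[ℂ] K) →L[ℂ] (L →L[ℂ] L) :=
  (ContinuousLinearMap.compL ℂ L K L V.adjoint) ∘L (ContinuousLinearMap.compL ℂ L K K).flip V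

theorem compress_apply (V : L →L[ℂ] K) (T : K →L[ℂ] K) :
    compress V T = V.adjoint ∘L T ∘L V := rfl

theorem inner_compress (V : L →L[ℂ] K) (T : K →L[ℂ] K) (l l' : L) :
    ⟪l', compress V T l⟫_ℂ = ⟪V l', T (V l)⟫_ℂ := by
  rw [compress_apply, ContinuousLinearMap.comp_apply, ContinuousLinearMap.adjoint_inner_right,
    ContinuousLinearMap.comp_apply]

theorem compress_opTensor (V : L →L[ℂ] K) (S : H →L[ℂ] H) (T : K →L[ℂ] K) :
    compress (idTensor H V) (opTensor S T) = opTensor S (compress V T) := by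
  refine ext_inner_tmul fun h l h' l' => ?_
  rw [inner_compress, idTensor_tmul, idTensor_tmul, opTensor_tmul, opTensor_tmul,
    inner_toHilbertTensor_tmul, inner_toHilbertTensor_tmul, inner_compress]

end Compression

/-! ### Finite-rank amplifications and separability of slices. -/

section Amplify

variable {A B H K : Type*} [NonUnitalCStarAlgebra A] [NonUnitalCStarAlgebra B]
  [NormedAddCommGroup H] [InnerProductSpace ℂ H] [CompleteSpace H]
  [NormedAddCommGroup K] [InnerProductSpace ℂ K] [CompleteSpace K]
  {π : A →⋆ₙₐ[ℂ] (H →L[ℂ] H)} {ρ : B →⋆ₙₐ[ℂ] (K →L[ℂ] K)}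

theorem exists_eq_sum_smul_of_finiteRank {E : Type*} [NormedAddCommGroup E] [NormedSpace ℂ E]
    (φ : E →L[ℂ] E) (hφ : FiniteDimensional ℂ (φ : E →ₗ[ℂ] E).range) :
    ∃ (m : ℕ) (a : Fin m → E) (ψ : Fin m → E →L[ℂ] ℂ), ∀ x, φ x = ∑ j, ψ j x • a j := by
  let b := Module.finBasis ℂ (φ : E →ₗ[ℂ] E).range
  let φ' : E →L[ℂ] (φ : E →ₗ[ℂ] E).range := φ.codRestrict _ fun x => ⟨x, rfl⟩
  refine ⟨_, fun j => (b j : E), fun j => (b.coord j).toContinuousLinearMap ∘L φ', fun x => ?_⟩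
  have h := congrArg ((↑) : (φ : E →ₗ[ℂ] E).range → E) (b.sum_repr (φ' x))
  simp only [Submodule.coe_sum, Submodule.coe_smul] at h
  exact h.symm

theorem amplify_eq_sum (hπ : Function.Injective π) (hρ : Function.Injective ρ) {φ : A →L[ℂ] A}
    {m : ℕ} {a : Fin m → A} {ψ : Fin m → A →L[ℂ] ℂ} (hφ : ∀ x, φ x = ∑ j, ψ j x • a j)
    (x : minTensor π ρ) :
    amplify π ρ φ x = ∑ j, opTensor (π (a j)) (ρ (slice π ρ (ψ j) x)) := by
  let g : minTensor π ρ →L[ℂ] (HilbertTensor H K →L[ℂ] HilbertTensor H K) :=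
    ∑ j, opTensorRep ρ (π (a j)) ∘L slice π ρ (ψ j)
  have hg : ∀ z, g (tensorIncl π ρ z)
      = (tensorRep π ρ ∘ₗ LinearMap.rTensor B (φ : A →ₗ[ℂ] A)) z := by
    intro z
    rw [LinearMap.comp_apply]
    simp only [g, sum_apply, ContinuousLinearMap.comp_apply, slice_tensorIncl hπ hρ]
    induction z with
    | zero => simp
    | add x y hx hy => simp only [map_add, Finset.sum_add_distrib, hx, hy]
    | tmul a' b =>
      rw [LinearMap.rTensor_tmul, ContinuousLinearMap.coe_coe, hφ, tensorRep_tmul,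
        ← opTensorLeft_apply, map_sum, map_sum]
      refine Finset.sum_congr rfl fun j _ => ?_
      rw [algSlice_tmul, map_smul, map_smul, map_smul]
      rfl
  have h : amplify π ρ φ = g :=
    LinearMap.extendOfNorm_unique (denseRange_tensorIncl π ρ) ‖g‖
      (fun z => by rw [← hg]; exact g.le_opNorm _) g (LinearMap.ext hg)
  rw [h]
  simp only [g, sum_apply, ContinuousLinearMap.comp_apply, opTensorRep_apply]

theorem slice_sub (hπ : Function.Injective π) (hρ : Function.Injective ρ) (φ φ' : A →L[ℂ] ℂ)
    (x : minTensor π ρ) : slice π ρ (φ - φ') x = slice π ρ φ x - slice π ρ φ' x := by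
  refine (denseRange_tensorIncl π ρ).induction_on
    (p := fun x => slice π ρ (φ - φ') x = slice π ρ φ x - slice π ρ φ' x) x
    (isClosed_eq (by fun_prop) (by fun_prop)) fun z => ?_
  simp only [slice_tensorIncl hπ hρ]
  induction z with
  | zero => simp
  | add x y hx hy => simp only [map_add, hx, hy]; abel
  | tmul a b => simp only [algSlice_tmul, sub_apply, sub_smul]

theorem slice_sum_smul (hπ : Function.Injective π) (hρ : Function.Injective ρ) {m : ℕ}
    (r : Fin m → ℂ) (ψ : Fin m → A →L[ℂ] ℂ) (x : minTensor π ρ) :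
    slice π ρ (∑ j, r j • ψ j) x = ∑ j, r j • slice π ρ (ψ j) x := by
  refine (denseRange_tensorIncl π ρ).induction_on
    (p := fun x => slice π ρ (∑ j, r j • ψ j) x = ∑ j, r j • slice π ρ (ψ j) x) x
    (isClosed_eq (by fun_prop) (by fun_prop)) fun z => ?_
  simp only [slice_tensorIncl hπ hρ]
  induction z with
  | zero => simp
  | add x y hx hy => simp only [map_add, smul_add, Finset.sum_add_distrib, hx, hy]
  | tmul a b =>
    simp only [algSlice_tmul, sum_apply, smul_apply, Finset.sum_smul, smul_smul, smul_eq_mul]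

/-- For finite-rank `φ`, the slice of `(φ ⊗ id)(c) - c` by `ω` is the slice of `c` by `ω ∘ φ - ω`.
All these differences thus have slices in one separable set, independent of `φ`. -/
theorem exists_slice_amplify_sub (hπ : Function.Injective π) (hρ : Function.Injective ρ)
    {m : ℕ} (a : Fin m → A) (ψ : Fin m → A →L[ℂ] ℂ) (c : minTensor π ρ) (ω : A →L[ℂ] ℂ) :
    ∃ ω', slice π ρ ω (∑ j, tensorIncl π ρ (a j ⊗ₜ slice π ρ (ψ j) c) - c) = slice π ρ ω' c := by
  refine ⟨∑ j, ω (a j) • ψ j - ω, ?_⟩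
  rw [slice_sub hπ hρ, slice_sum_smul hπ hρ, map_sub, map_sum]
  simp only [slice_tensorIncl hπ hρ, algSlice_tmul]

/-- The slices of an element of `A ⊗ B` form a separable set. -/
theorem isSeparable_range_slice (hπ : Function.Injective π) (hρ : Function.Injective ρ)
    (c : minTensor π ρ) : TopologicalSpace.IsSeparable (Set.range fun φ => slice π ρ φ c) := by
  obtain ⟨u, hu, hlim⟩ := mem_closure_iff_seq_limit.1 (denseRange_tensorIncl π ρ c)
  choose z hz using hu
  have hsep : ∀ k, TopologicalSpace.IsSeparable (Set.range fun φ => slice π ρ φ (u k)) := by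
    intro k
    obtain ⟨ι, _, x, b, -, hzk⟩ := exists_sum_selfAdjoint_tmul (z k)
    refine (TopologicalSpace.isSeparable_range
      (f := fun r : ι → ℂ => ∑ i, r i • b i) (by fun_prop)).mono ?_
    rintro _ ⟨φ, rfl⟩
    refine ⟨fun i => φ (x i), ?_⟩
    simp only [← hz, slice_tensorIncl hπ hρ, hzk, map_sum, algSlice_tmul]
  refine (TopologicalSpace.IsSeparable.iUnion hsep).closure.mono ?_
  rintro _ ⟨φ, rfl⟩
  refine mem_closure_of_tendsto (((slice π ρ φ).continuous.tendsto c).comp hlim)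
    (Filter.Eventually.of_forall fun k => Set.mem_iUnion.2 ⟨k, φ, rfl⟩)

end Amplify

/-! ### The case of the strong operator approximation property. -/

section SOAP

open scoped InnerProductSpace

variable {A B H K : Type*} [NonUnitalCStarAlgebra A] [NonUnitalCStarAlgebra B]
  [NormedAddCommGroup H] [InnerProductSpace ℂ H] [CompleteSpace H]
  [NormedAddCommGroup K] [InnerProductSpace ℂ K] [CompleteSpace K]
  {π : A →⋆ₙₐ[ℂ] (H →L[ℂ] H)} {ρ : B →⋆ₙₐ[ℂ] (K →L[ℂ] K)}

/-- For a separable set `E` in `B` there is `V : ℓ² → K` such that compression by `1 ⊗ V` does not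
decrease the norm of elements of `A ⊗ B` whose slices are in `E`. -/
theorem exists_compress_norm_ge (hπ : Function.Injective π) (hρ : Function.Injective ρ)
    {E : Set B} (hE : TopologicalSpace.IsSeparable E) :
    ∃ V : ellTwo →L[ℂ] K, ∀ x : minTensor π ρ, (∀ φ, slice π ρ φ x ∈ E) →
      ‖x‖ ≤ ‖compress (idTensor H V) (x : HilbertTensor H K →L[ℂ] HilbertTensor H K)‖ := by
  have hEsep := hE.separableSpace
  let 𝒯 : ∀ n : ℕ, Set (PiLp 2 (fun _ : Fin n => K) →L[ℂ] PiLp 2 (fun _ : Fin n => K)) :=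
    fun n => Set.range fun t : Fin n → Fin n → E => matOp fun i j => repL ρ (t i j)
  have h𝒯 : ∀ n, TopologicalSpace.IsSeparable (𝒯 n) := fun n =>
    TopologicalSpace.isSeparable_range (continuous_matOp.comp (by fun_prop))
  choose D hDc hD using fun n => exists_countable_norming (h𝒯 n)
  have hcount : (⋃ n, ⋃ i : Fin n, (fun ξ : PiLp 2 (fun _ : Fin n => K) => ξ i) '' D n).Countable :=
    Set.countable_iUnion fun n => Set.countable_iUnion fun i => (hDc n).image _
  obtain ⟨V, hV⟩ := exists_ellTwo_map hcount
  refine ⟨V, fun x hx => norm_le_of_matRep_sliceMatrix hπ hρ (norm_nonneg _) fun n e he => ?_⟩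
  -- The slice matrix has entries in `E`, so it is normed by `D n`. The coordinates of those vectors
  -- lift to `ℓ²` without change of norm, which turns each coefficient into one of the compression.
  refine hD n _ ⟨fun i j => ⟨_, hx (vecFunctional (e j) (e i) ∘L repL π)⟩, rfl⟩ _ (norm_nonneg _)
    fun ξ hξ η hη => ?_
  have hlift : ∀ ξ ∈ D n, ∃ ξ' : PiLp 2 (fun _ : Fin n => ellTwo),
      (WithLp.toLp 2 fun i => V (ξ' i)) = ξ ∧ ‖ξ'‖ = ‖ξ‖ := by
    intro ξ hξ
    choose k hk hkn using fun i : Fin n =>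
      hV (ξ i) (Set.mem_iUnion.2 ⟨n, Set.mem_iUnion.2 ⟨i, ξ, hξ, rfl⟩⟩)
    refine ⟨WithLp.toLp 2 k, ?_, ?_⟩
    · ext i
      exact hk i
    · rw [PiLp.norm_eq_of_L2, PiLp.norm_eq_of_L2]
      simp only [hkn]
  obtain ⟨ξ', hξ', hξn⟩ := hlift ξ hξ
  obtain ⟨η', hη', hηn⟩ := hlift η hη
  have hinner := inner_frameMap_eq hπ hρ e x ξ η
  rw [matRep_apply] at hinner
  change ‖⟪η, matOp (fun i j => ρ (sliceMatrix π ρ e x i j)) ξ⟫_ℂ‖ ≤ _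
  rw [← hinner, ← hξ', ← hη', ← idTensor_frameMap, ← idTensor_frameMap, ← inner_compress, hξ', hη']
  refine (norm_inner_le_norm _ _).trans ?_
  have := (compress (idTensor H V)
    (x : HilbertTensor H K →L[ℂ] HilbertTensor H K)).le_opNorm (frameMap ellTwo e ξ')
  rw [norm_frameMap he, hξn] at this
  rw [norm_frameMap he, hηn]
  calc _ ≤ ‖η‖ * (‖compress (idTensor H V)
        (x : HilbertTensor H K →L[ℂ] HilbertTensor H K)‖ * ‖ξ‖) := by gcongr
    _ = _ := by ring

theorem compress_tensorRep (V : ellTwo →L[ℂ] K) (z : A ⊗[ℂ] B) :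
    compress (idTensor H V) (tensorRep π ρ z)
      = tensorRep π (NonUnitalStarAlgHom.id ℂ (ellTwo →L[ℂ] ellTwo))
        (LinearMap.lTensor A (compress V ∘L repL ρ : B →ₗ[ℂ] (ellTwo →L[ℂ] ellTwo)) z) := by
  induction z with
  | zero => simp
  | add x y hx hy => simp only [map_add, hx, hy]
  | tmul a b =>
    rw [LinearMap.lTensor_tmul, tensorRep_tmul, tensorRep_tmul, compress_opTensor]
    rfl

theorem compress_mem_minTensor (V : ellTwo →L[ℂ] K) (x : minTensor π ρ) :
    compress (idTensor H V) (x : HilbertTensor H K →L[ℂ] HilbertTensor H K) ∈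
      minTensor π (NonUnitalStarAlgHom.id ℂ (ellTwo →L[ℂ] ellTwo)) := by
  refine (denseRange_tensorIncl π ρ).induction_on
    (p := fun x : minTensor π ρ =>
      compress (idTensor H V) (x : HilbertTensor H K →L[ℂ] HilbertTensor H K) ∈
        minTensor π (NonUnitalStarAlgHom.id ℂ (ellTwo →L[ℂ] ellTwo))) x ?_ fun z => ?_
  · exact (isClosed_minTensor _ _).preimage
      ((compress (idTensor H V)).continuous.comp continuous_subtype_val)
  · rw [coe_tensorIncl, compress_tensorRep]
    exact tensorRep_mem _ _ _

theorem slice_compress (hπ : Function.Injective π) (hρ : Function.Injective ρ)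
    (V : ellTwo →L[ℂ] K) (φ : A →L[ℂ] ℂ) (x : minTensor π ρ) :
    slice π (NonUnitalStarAlgHom.id ℂ (ellTwo →L[ℂ] ellTwo)) φ ⟨_, compress_mem_minTensor V x⟩
      = compress V (ρ (slice π ρ φ x)) := by
  have hid : Function.Injective (NonUnitalStarAlgHom.id ℂ (ellTwo →L[ℂ] ellTwo)) :=
    Function.injective_id
  refine (denseRange_tensorIncl π ρ).induction_on
    (p := fun x => slice π (NonUnitalStarAlgHom.id ℂ (ellTwo →L[ℂ] ellTwo)) φ
      ⟨_, compress_mem_minTensor V x⟩ = compress V (repL ρ (slice π ρ φ x))) x ?_ fun z => ?_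
  · refine isClosed_eq ((slice π _ φ).continuous.comp ?_) (by fun_prop)
    exact Continuous.subtype_mk
      ((compress (idTensor H V)).continuous.comp continuous_subtype_val) _
  · have h : (⟨_, compress_mem_minTensor V (tensorIncl π ρ z)⟩ :
        minTensor π (NonUnitalStarAlgHom.id ℂ (ellTwo →L[ℂ] ellTwo)))
        = tensorIncl π _
          (LinearMap.lTensor A (compress V ∘L repL ρ : B →ₗ[ℂ] (ellTwo →L[ℂ] ellTwo)) z) :=
      Subtype.ext (compress_tensorRep V z)
    rw [h, slice_tensorIncl hπ hid, slice_tensorIncl hπ hρ]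
    clear h
    induction z with
    | zero => simp
    | add x y hx hy => simp only [map_add, hx, hy]
    | tmul a b =>
      rw [LinearMap.lTensor_tmul, algSlice_tmul, algSlice_tmul, map_smul, map_smul]
      rfl

/-- Under the strong operator approximation property, every element of `A ⊗ B` whose slices are in
`S` belongs to `A ⊗ S`. -/
theorem mem_minTensor_subtype_of_hasSOAP (hπ : Function.Injective π)
    (hρ : Function.Injective ρ) {S : NonUnitalStarSubalgebra ℂ B} (hA : HasSOAP π)
    (c : minTensor π ρ) (hc : ∀ φ, slice π ρ φ c ∈ S) :
    (c : HilbertTensor H K →L[ℂ] HilbertTensor H K) ∈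
      minTensor π (ρ.comp (NonUnitalStarSubalgebraClass.subtype S)) := by
  obtain ⟨l, hl, hfin, hlim⟩ := hA
  have hid : Function.Injective (NonUnitalStarAlgHom.id ℂ (ellTwo →L[ℂ] ellTwo)) :=
    Function.injective_id
  obtain ⟨V, hV⟩ := exists_compress_norm_ge hπ hρ (isSeparable_range_slice hπ hρ c)
  let c' : minTensor π (NonUnitalStarAlgHom.id ℂ (ellTwo →L[ℂ] ellTwo)) :=
    ⟨_, compress_mem_minTensor V c⟩
  -- Compression commutes with `φ ⊗ id` and, by the choice of `V`, does not shrink these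
  -- differences. Convergence for `c'` over `ℓ²` therefore forces convergence for `c`.
  have hbound : ∀ᶠ φ in l, ‖amplify π ρ φ c - c‖ ≤
      ‖amplify π (NonUnitalStarAlgHom.id ℂ (ellTwo →L[ℂ] ellTwo)) φ c' - c'‖ := by
    filter_upwards [hfin] with φ hφ
    obtain ⟨m, a, ψ, hφa⟩ := exists_eq_sum_smul_of_finiteRank φ hφ
    let x : minTensor π ρ := ∑ j, tensorIncl π ρ (a j ⊗ₜ slice π ρ (ψ j) c) - c
    have hx : (x : HilbertTensor H K →L[ℂ] HilbertTensor H K) = amplify π ρ φ c - c := by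
      rw [amplify_eq_sum hπ hρ hφa]
      simp [x]
    have hx' : compress (idTensor H V) (x : HilbertTensor H K →L[ℂ] HilbertTensor H K)
        = amplify π (NonUnitalStarAlgHom.id ℂ (ellTwo →L[ℂ] ellTwo)) φ c' - c' := by
      rw [hx, map_sub, amplify_eq_sum hπ hid hφa, amplify_eq_sum hπ hρ hφa, map_sum]
      congr 1
      refine Finset.sum_congr rfl fun j _ => ?_
      rw [slice_compress hπ hρ, compress_opTensor]
      rfl
    rw [← hx, ← hx']
    refine hV x fun ω => ?_
    obtain ⟨ω', hω'⟩ := exists_slice_amplify_sub hπ hρ a ψ c ω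
    exact ⟨ω', hω'.symm⟩
  have htend : Filter.Tendsto (fun φ => amplify π ρ φ c) l
      (nhds (c : HilbertTensor H K →L[ℂ] HilbertTensor H K)) := by
    rw [tendsto_iff_norm_sub_tendsto_zero]
    exact squeeze_zero' (Filter.Eventually.of_forall fun _ => norm_nonneg _) hbound
      (tendsto_iff_norm_sub_tendsto_zero.1 (hlim c'))
  refine (isClosed_minTensor _ _).mem_of_tendsto htend ?_
  filter_upwards [hfin] with φ hφ
  obtain ⟨m, a, ψ, hφa⟩ := exists_eq_sum_smul_of_finiteRank φ hφ
  rw [amplify_eq_sum hπ hρ hφa]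
  exact sum_mem fun j _ => opTensor_mem_minTensor_subtype _ (hc _)

end SOAP

end TensorSplitting

end

theorem mainTheorem10 {A B H K : Type*}
    [NonUnitalCStarAlgebra A] [NonUnitalCStarAlgebra B]
    [NormedAddCommGroup H] [InnerProductSpace ℂ H] [CompleteSpace H]
    [NormedAddCommGroup K] [InnerProductSpace ℂ K] [CompleteSpace K]
    (hA : TensorSplitting.IsSimple A)
    (π : A →⋆ₙₐ[ℂ] (H →L[ℂ] H)) (hπ : Function.Injective π)
    (ρ : B →⋆ₙₐ[ℂ] (K →L[ℂ] K)) (hρ : Function.Injective ρ)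
    (C : NonUnitalStarSubalgebra ℂ
      (TensorSplitting.HilbertTensor H K →L[ℂ] TensorSplitting.HilbertTensor H K))
    (hCclosed : IsClosed (C : Set
      (TensorSplitting.HilbertTensor H K →L[ℂ] TensorSplitting.HilbertTensor H K)))
    (hC : C ≤ TensorSplitting.minTensor π ρ)
    (hAC : ∀ (a : A), ∀ c ∈ C,
      TensorSplitting.opTensor (π a) (1 : K →L[ℂ] K) * c ∈ C ∧
      c * TensorSplitting.opTensor (π a) (1 : K →L[ℂ] K) ∈ C) :
    ∃ S : NonUnitalStarSubalgebra ℂ B,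
      (S : Set B) = TensorSplitting.sliceSet π ρ C ∧
      IsClosed (S : Set B) ∧
      TensorSplitting.minTensor π
        (ρ.comp (NonUnitalStarSubalgebraClass.subtype S)) ≤ C ∧
      (TensorSplitting.HasSOAP π ∨ TensorSplitting.HasCBProjection S →
        C = TensorSplitting.minTensor π
          (ρ.comp (NonUnitalStarSubalgebraClass.subtype S))) := by
  obtain ⟨S, hS, hSclosed, hSC⟩ :=
    TensorSplitting.exists_subalgebra_eq_sliceSet hA hπ hρ hCclosed hC hAC
  have hle := TensorSplitting.minTensor_subtype_le hCclosed hSC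
  have hslice : ∀ c, (hc : c ∈ C) → ∀ φ,
      TensorSplitting.slice π ρ φ ⟨c, hC hc⟩ ∈ S := by
    intro c hc φ
    rw [← SetLike.mem_coe, hS]
    exact ⟨φ, ⟨c, hC hc⟩, hc, rfl⟩
  refine ⟨S, hS, hSclosed, hle, fun h => le_antisymm (fun c hc => ?_) hle⟩
  rcases h with h | h
  · exact TensorSplitting.mem_minTensor_subtype_of_hasSOAP hπ hρ h ⟨c, hC hc⟩ (hslice c hc)
  · exact TensorSplitting.mem_minTensor_subtype_of_hasCBProjection hπ hρ h ⟨c, hC hc⟩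
      (hslice c hc)
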